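/- **The model (2HAM).** A glue is a pair (label, strength), the label a finite string and the strength in $\mathbb N$; a tile type assigns a glue to each of the four sides of a unit square; a tile set is a finite set of tile types. An assembly over a tile set $T$ is a partial function $\alpha:\mathbb Z^2\dashrightarrow T$; a supertile is the class of all translates of an assembly. Two adjacent tiles of $\alpha$ are joined by an edge of the binding graph if their abutting glues are equal, with weight the strength of that glue; $\alpha$ is $\tau$-stable if every cut of its binding graph has weight at least $\tau$. $C^\tau_{a,b}$ is the set of all $\tau$-stable supertiles of the form $\alpha\cup\beta$ with $\alpha\in a$, $\beta\in b$ and disjoint domains. A state over $T$ is a function from supertiles over $T$ to $\mathbb N\cup\{\infty\}$ (multiplicities). A tile assembly system (TAS) is a triple $\mathcal T=(T,S,\tau)$ with $T$ a tile set, $S$ a state over $T$ (the initial state, or initial configuration), and $\tau\in\mathbb N$; the default initial state has infinitely many copies of each single tile and nothing else. A step of $\mathcal T$ from one state to the next removes one copy each of two supertiles $a,b$ and adds one copy of some $g\in C^\tau_{a,b}$. Following one supertile through a finite or infinite sequence of states connected by such steps (at each step it stays, or is attached to another supertile and replaced by the product) gives a supertile assembly sequence, whose result is the union of its members. Write $a\to_{\mathcal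 T} b$ if $b$ is the result of such a sequence that starts with $a$, from any state; $a\to^1_{\mathcal T} b$ if one attachment turns $a$ into $b$; $a\to^{\le1}_{\mathcal T} b$ if $a=b$ or $a\to^1_{\mathcal T}b$. A supertile is producible if it is the result of a sequence whose first state is $S$; it is terminal if it is producible and $C^\tau_{a,b}=\emptyset$ for this supertile $a$ and every producible $b$. **Strong simulation.** Let $\mathcal U=(U,S_{\mathcal T},\tau')$ and $\mathcal T=(T,S,\tau)$ be TASs. For $m\ge1$ and a partial function $R$ from $m\times m$ blocks over $U$ (each position empty or a tile of $U$) to $T$, let $R^*(\alpha)$ be the assembly over $T$ obtained by applying $R$ to each block $\alpha^m_{x,y}$ of $\alpha$. The assembly $\alpha$ maps cleanly to $R^*(\alpha)$ if each nonempty block of $\alpha$ is at, or directly north, south, east or west of, a position in the domain of $R^*(\alpha)$, or else $\alpha$ has at most one nonempty block. $\mathcal U$ *strongly simulates* $\mathcal T$ if there are $m\ge 1$, such an $R$, and a map $\tilde R$ from supertiles over $U$ to supertiles over $T$ such that: 1. each producible $a$ of $\mathcal U$ contains an assembly $\alpha$ (that is, $a$ can be aligned with the block grid) which maps cleanly to $R^*(\alpha)$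 and satisfies $R^*(\alpha)\in\tilde R(a)$; the image under $\tilde R$ of the producible supertiles of $\mathcal U$ is the set of producible supertiles of $\mathcal T$; and the same holds for the terminal supertiles; 2. for all producible $a,b$ of $\mathcal U$ with $a\to^1_{\mathcal U}b$, one has $\tilde R(a)\to^{\le1}_{\mathcal T}\tilde R(b)$; 3. for all producible $a,b$ of $\mathcal T$, all $g\in C^\tau_{a,b}$, and all producible $a',b'$ of $\mathcal U$ with $\tilde R(a')=a$, $\tilde R(b')=b$, there are producible $a'',b'',g'$ of $\mathcal U$ with $a'\to_{\mathcal U}a''$, $b'\to_{\mathcal U}b''$, $\tilde R(a'')=a$, $\tilde R(b'')=b$, $\tilde R(g')=g$ and $g'\in C^{\tau'}_{a'',b''}$. **Uniform mappings.** There is a uniform mapping from $\tau$ to $\tau'$ if there is a function $M:\{1,\dots,\tau\}\to\{1,\dots,\tau'\}$ such that for every finite multiset $X$ of elements of $\{1,\dots,\tau\}$: $\sum_{x\in X}M(x)\ge\tau'$ if and only if $\sum_{x\in X}x\ge\tau$. **Theorem.** Let $\tau,\tau'\in\mathbb N$ with $2<\tau<\tau'$ be such that there is no uniform mapping from $\tau$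 to $\tau'$. Then for every tile set $U$ there is a tile set $T$ such that, with $\mathcal T=(T,S,\tau)$ the TAS at temperature $\tau$ with the default initial state $S$, for every initial configuration $S_{\mathcal T}$ over $U$ the TAS $(U,S_{\mathcal T},\tau')$ does not strongly simulate $\mathcal T$. -/

import Mathlib

/-! The two-handed assembly model (2HAM), strong simulation, and uniform mappings. -/

namespace TwoHAM

/-- A glue: a label (a finite string) and a strength. -/
structure Glue where
  label : String
  strength : ℕ

/-- The four sides of a tile. -/
inductive Dir where
  | north
  | east
  | south
  | west

/-- The unit vector of a side. -/
def Dir.vec : Dir → ℤ × ℤ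
  | .north => (0, 1)
  | .east => (1, 0)
  | .south => (0, -1)
  | .west => (-1, 0)

/-- The opposite side. -/
def Dir.opp : Dir → Dir
  | .north => .south
  | .east => .west
  | .south => .north
  | .west => .east

/-- A tile type: a unit square (not to be rotated) with a glue on each side. -/
structure TileType where
  glue : Dir → Glue

/-- An assembly over the finite tile set `T`: a partial function from `ℤ²` to `T`. -/
abbrev Assembly (T : Finset TileType) : Type := ℤ × ℤ → Option {t : TileType // t ∈ T}

namespace Assembly

variable {T : Finset TileType}

/-- The domain of an assembly. -/
def dom (α : Assembly T) : Set (ℤ × ℤ) := {p | α p ≠ none}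

/-- The translate `α + u`. -/
def translate (α : Assembly T) (u : ℤ × ℤ) : Assembly T := fun p => α (p - u)

/-- The union of two assemblies, the first one taking precedence. -/
def union (α β : Assembly T) : Assembly T := fun p => (α p).or (β p)

/-- Two assemblies are disjoint if their domains are. -/
def IsDisjoint (α β : Assembly T) : Prop := Disjoint α.dom β.dom

/-- The assembly consisting of one tile of type `t`, placed at the origin. -/
def single (t : {t : TileType // t ∈ T}) : Assembly T := fun p => if p = 0 then some t else none

open Classical in
/-- The weight of the edge of the binding graph of `α` between `p` and its neighbour on side `d`:
the common strength of the abutting glues if both positions carry tiles and these two glues are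
equal, and `0` (no edge) otherwise. -/
noncomputable def bond (α : Assembly T) (p : ℤ × ℤ) (d : Dir) : ℕ :=
  match α p, α (p + d.vec) with
  | some s, some t => if s.1.glue d = t.1.glue d.opp then (s.1.glue d).strength else 0
  | _, _ => 0

/-- `α` is `τ`-stable: every cut of its binding graph (a set `X` of positions separating the domain
into two nonempty parts) has weight at least `τ`. A pair `(p, d)` with `p ∈ X` and
`p + d.vec ∉ X` names an edge across the cut, and every such edge once. The weight of a cut is a
possibly infinite sum of natural numbers; it is at least `τ` if and only if some finite
part of it is. -/
def Stable (τ : ℕ) (α : Assembly T) : Prop :=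
  ∀ X : Set (ℤ × ℤ), (α.dom ∩ X).Nonempty → (α.dom \ X).Nonempty →
    ∃ F : Finset ((ℤ × ℤ) × Dir),
      (∀ e ∈ F, e.1 ∈ X ∧ e.1 + e.2.vec ∉ X) ∧ τ ≤ ∑ e ∈ F, α.bond e.1 e.2

end Assembly

/-- Two assemblies are equivalent if one is a translate of the other. -/
def assemblySetoid (T : Finset TileType) : Setoid (Assembly T) where
  r α β := ∃ u : ℤ × ℤ, α.translate u = β
  iseqv :=
    { refl := fun α => ⟨0, by funext p; simp [Assembly.translate]⟩
      symm := by
        rintro α β ⟨u, rfl⟩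
        exact ⟨-u, by funext p; simp [Assembly.translate]⟩
      trans := by
        rintro α β γ ⟨u, rfl⟩ ⟨v, rfl⟩
        exact ⟨u + v, by funext p; simp only [Assembly.translate]; congr 1; abel⟩ }

/-- Supertiles: assemblies up to translation. -/
def Supertile (T : Finset TileType) : Type := Quotient (assemblySetoid T)

/-- The supertile of an assembly. -/
def Assembly.supertile {T : Finset TileType} (α : Assembly T) : Supertile T :=
  Quotient.mk (assemblySetoid T) α

/-- The combination set `C^τ_{a,b}`: all `τ`-stable supertiles obtained by placing `a` and `b`
without overlap. -/
def Combination {T : Finset TileType} (τ : ℕ) (a b : Supertile T) : Set (Supertile T) :=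
  {g | ∃ α β : Assembly T, α.supertile = a ∧ β.supertile = b ∧ α.IsDisjoint β ∧
    (α.union β).Stable τ ∧ (α.union β).supertile = g}

/-- A state: a multiset of supertiles, with multiplicities in `ℕ ∪ {∞}`. -/
abbrev State (T : Finset TileType) : Type := Supertile T → ℕ∞

open Classical in
/-- The default initial state: infinitely many copies of each single tile and nothing else. -/
noncomputable def defaultState (T : Finset TileType) : State T :=
  fun a => if ∃ t, (Assembly.single t).supertile = a then ⊤ else 0

/-- A (two-handed) tile assembly system: a finite tile set, an initial state, a temperature. -/
structure TAS where
  tiles : Finset TileType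
  init : State tiles
  temp : ℕ

/-- The state `S'` results from the state `S` at temperature `τ` by attaching one copy of `a` and
one copy of `b`, with product `g`. (With `S' a + 1 = S a`, at least one copy of `a` is present in
`S`, and `∞ - 1 = ∞`.) -/
def Reaction {T : Finset TileType} (τ : ℕ) (S S' : State T) (a b g : Supertile T) : Prop :=
  g ∈ Combination τ a b ∧ S' g = S g + 1 ∧
  (a ≠ b → S' a + 1 = S a ∧ S' b + 1 = S b) ∧ (a = b → S' a + 2 = S a) ∧
  ∀ w, w ≠ a → w ≠ b → w ≠ g → S' w = S w

/-- A supertile assembly sequence `(α i | 0 ≤ i < k)`, `1 ≤ k ≤ ∞`, inside the assembly sequence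
`(S i | 0 ≤ i < k)` at temperature `τ`. The supertiles are followed through representatives kept in
place: at each step, either the followed supertile takes part in the attachment, and its successor
is the product, or it does not, a copy of it stays in the state, and it is its own successor. Values
of `S` and `α` at indices from `k` on are irrelevant. -/
def IsAssemblySequence {T : Finset TileType} (τ : ℕ) (k : ℕ∞) (S : ℕ → State T)
    (α : ℕ → Assembly T) : Prop :=
  1 ≤ k ∧ S 0 (α 0).supertile ≠ 0 ∧
  ∀ i : ℕ, ((i + 1 : ℕ) : ℕ∞) < k →
    (∃ β : Assembly T, (α i).IsDisjoint β ∧ α (i + 1) = (α i).union β ∧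
      (α (i + 1)).Stable τ ∧
      Reaction τ (S i) (S (i + 1)) (α i).supertile β.supertile (α (i + 1)).supertile) ∨
    (∃ a b g : Supertile T, Reaction τ (S i) (S (i + 1)) a b g ∧
      α (i + 1) = α i ∧ S (i + 1) (α i).supertile ≠ 0)

/-- `ω` is the result of the sequence `(α i | 0 ≤ i < k)`: its domain is the union of theirs and
each `α i` is a subassembly of `ω`. -/
def IsResult {T : Finset TileType} (k : ℕ∞) (α : ℕ → Assembly T) (ω : Assembly T) : Prop :=
  ω.dom = {p | ∃ i : ℕ, (i : ℕ∞) < k ∧ p ∈ (α i).dom} ∧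
  ∀ i : ℕ, (i : ℕ∞) < k → ∀ p ∈ (α i).dom, ω p = α i p

namespace TAS

/-- `a →_𝒯 b`: `b` is the result of a (not necessarily nascent) supertile assembly sequence that
starts with `a`. -/
def Reaches (𝒯 : TAS) (a b : Supertile 𝒯.tiles) : Prop :=
  ∃ (k : ℕ∞) (S : ℕ → State 𝒯.tiles) (α : ℕ → Assembly 𝒯.tiles) (ω : Assembly 𝒯.tiles),
    IsAssemblySequence 𝒯.temp k S α ∧ (α 0).supertile = a ∧ IsResult k α ω ∧ ω.supertile = b

/-- `a →¹_𝒯 b`: one attachment turns `a` into `b`. -/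
def ReachesOne (𝒯 : TAS) (a b : Supertile 𝒯.tiles) : Prop :=
  ∃ (S S' : State 𝒯.tiles) (x : Supertile 𝒯.tiles), Reaction 𝒯.temp S S' a x b

/-- `a →^{≤1}_𝒯 b`. -/
def ReachesLeOne (𝒯 : TAS) (a b : Supertile 𝒯.tiles) : Prop := a = b ∨ 𝒯.ReachesOne a b

/-- The producible supertiles: the results of nascent supertile assembly sequences. -/
def producible (𝒯 : TAS) : Set (Supertile 𝒯.tiles) :=
  {b | ∃ (k : ℕ∞) (S : ℕ → State 𝒯.tiles) (α : ℕ → Assembly 𝒯.tiles) (ω : Assembly 𝒯.tiles),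
    S 0 = 𝒯.init ∧ IsAssemblySequence 𝒯.temp k S α ∧ IsResult k α ω ∧ ω.supertile = b}

/-- The terminal (and producible) supertiles. -/
def terminal (𝒯 : TAS) : Set (Supertile 𝒯.tiles) :=
  {a | a ∈ 𝒯.producible ∧ ∀ b ∈ 𝒯.producible, Combination 𝒯.temp a b = ∅}

end TAS

/-- An `m`-block assembly (macrotile) over `U`. -/
abbrev Block (U : Finset TileType) (m : ℕ) : Type :=
  Fin m × Fin m → Option {t : TileType // t ∈ U}

/-- The block is not the empty one. -/
def Block.Nonempty {U : Finset TileType} {m : ℕ} (γ : Block U m) : Prop := ∃ ij, γ ij ≠ none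

/-- The `m`-block `α^m_{x,y}` of an assembly. -/
def Assembly.block {U : Finset TileType} (α : Assembly U) (m : ℕ) (p : ℤ × ℤ) : Block U m :=
  fun ij => α ((m : ℤ) * p.1 + (ij.1 : ℕ), (m : ℤ) * p.2 + (ij.2 : ℕ))

section Simulation

variable {U T : Finset TileType} {m : ℕ}

/-- The assembly representation function `R*` of an `m`-block representation function. -/
def assemblyRep (R : Block U m → Option {t : TileType // t ∈ T}) (α : Assembly U) : Assembly T :=
  fun p => R (α.block m p)

/-- `α` maps cleanly to `R*(α)`: fuzz is allowed only directly north, south, east or west of a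
block that represents a tile, or else `α` has at most one nonempty block. -/
def MapsCleanly (R : Block U m → Option {t : TileType // t ∈ T}) (α : Assembly U) : Prop :=
  (∀ p : ℤ × ℤ, (α.block m p).Nonempty →
    ∃ u v : ℤ, u ∈ ({-1, 0, 1} : Set ℤ) ∧ v ∈ ({-1, 0, 1} : Set ℤ) ∧ u ^ 2 + v ^ 2 < 2 ∧
      (p.1 + u, p.2 + v) ∈ (assemblyRep R α).dom) ∨
  (∀ p q : ℤ × ℤ, (α.block m p).Nonempty → (α.block m q).Nonempty → p = q)

/-- `ρ` is a supertile representation function `R̃` for the `m`-block representation function `R` on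
the supertiles in `P`: each of them, when suitably aligned with the grid of `m`-blocks, maps cleanly
under `R*` to the supertile that `ρ` assigns to it. -/
def IsSupertileRep (R : Block U m → Option {t : TileType // t ∈ T})
    (ρ : Supertile U → Supertile T) (P : Set (Supertile U)) : Prop :=
  ∀ a ∈ P, ∃ α : Assembly U, α.supertile = a ∧ (assemblyRep R α).supertile = ρ a ∧
    MapsCleanly R α

end Simulation

/-- `𝒰` and `𝒯` have equivalent productions, through `R` and `ρ`. -/
def EquivalentProductions (𝒰 𝒯 : TAS) {m : ℕ}
    (R : Block 𝒰.tiles m → Option {t : TileType // t ∈ 𝒯.tiles})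
    (ρ : Supertile 𝒰.tiles → Supertile 𝒯.tiles) : Prop :=
  ρ '' 𝒰.producible = 𝒯.producible ∧ ρ '' 𝒰.terminal = 𝒯.terminal ∧
  IsSupertileRep R ρ 𝒰.producible

/-- `𝒯` follows `𝒰`. -/
def Follows (𝒯 𝒰 : TAS) (ρ : Supertile 𝒰.tiles → Supertile 𝒯.tiles) : Prop :=
  ∀ a ∈ 𝒰.producible, ∀ b ∈ 𝒰.producible, 𝒰.ReachesOne a b → 𝒯.ReachesLeOne (ρ a) (ρ b)

/-- `𝒰` strongly models `𝒯`. -/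
def StronglyModels (𝒰 𝒯 : TAS) (ρ : Supertile 𝒰.tiles → Supertile 𝒯.tiles) : Prop :=
  ∀ a ∈ 𝒯.producible, ∀ b ∈ 𝒯.producible, ∀ g ∈ Combination 𝒯.temp a b,
    ∀ a' ∈ 𝒰.producible, ∀ b' ∈ 𝒰.producible, ρ a' = a → ρ b' = b →
      ∃ a'' ∈ 𝒰.producible, ∃ b'' ∈ 𝒰.producible, ∃ g' ∈ 𝒰.producible,
        𝒰.Reaches a' a'' ∧ 𝒰.Reaches b' b'' ∧ ρ a'' = a ∧ ρ b'' = b ∧ ρ g' = g ∧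
        g' ∈ Combination 𝒰.temp a'' b''

/-- `𝒰` strongly simulates `𝒯`, at some scale factor `m ≥ 1` and through some `m`-block
representation function. -/
def StronglySimulates (𝒰 𝒯 : TAS) : Prop :=
  ∃ (m : ℕ) (R : Block 𝒰.tiles m → Option {t : TileType // t ∈ 𝒯.tiles})
    (ρ : Supertile 𝒰.tiles → Supertile 𝒯.tiles),
    1 ≤ m ∧ EquivalentProductions 𝒰 𝒯 R ρ ∧ Follows 𝒯 𝒰 ρ ∧ StronglyModels 𝒰 𝒯 ρ

/-- `M` restricts to a uniform mapping from `{1, …, Q}` to `{1, …, R}`. -/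
def IsUniformMapping (Q R : ℕ) (M : ℕ → ℕ) : Prop :=
  (∀ x ∈ Set.Icc 1 Q, M x ∈ Set.Icc 1 R) ∧
  ∀ S : Multiset ℕ, (∀ x ∈ S, x ∈ Set.Icc 1 Q) → (R ≤ (S.map M).sum ↔ Q ≤ S.sum)

/-- There is a uniform mapping from `τ` to `τ'`. -/
def HasUniformMapping (τ τ' : ℕ) : Prop := ∃ M : ℕ → ℕ, IsUniformMapping τ τ' M

end TwoHAM

/-!
# No strong simulation at a temperature without a uniform mapping

A number `c` with `(τ - 1) * c < τ' ≤ τ * c` would give the uniform mapping `x ↦ min (c * x) τ'`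
(`le_mul_of_not_hasUniformMapping`). So it is enough to find a tile set for which a strong
simulation would produce such a `c`, as the strength that the simulator gives to a contact of
strength `1`.

The tile set `combTiles τ` assembles left combs and right combs of any height and with teeth in any
rows. All bonds inside a comb have strength `τ`. The tips of a left and a right tooth in the same
row bind with strength `1`, so that two combs placed face to face bind if and only if they have `τ`
common teeth.

Suppose that this tile set is simulated, with blocks of size `m`. Every comb has a representation
that is stable and does not grow any more while it represents the comb (`exists_rep_comb`). What a
representation looks like around a tooth is one of finitely many patterns (`window`). Let the combs
have a large number of slots for teeth, with a choice of rows in each slot. A pigeonhole argument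
(`exists_monochromatic_box`) gives two rows in each slot such that these patterns depend neither on
which of the two rows is chosen in which slot, nor, for `τ` of the slots, on the slot. Take a left
and a right comb whose rows agree in exactly these `τ` slots. Their representations have to bind,
at some offset `δ`, which is nearly the right one (`abs_le_of_near_union`). Therefore they interact
only around the common teeth, and by the same strength `c` at each of them, whence `τ' ≤ τ * c` and
so `τ' ≤ (τ - 1) * c`. A right comb that agrees in only `τ - 1` of the slots has a representation
with the same patterns, so that this representation also binds to the left one, at the same offset
(`stable_of_fewer_teeth`).

The product is producible in the simulating system even if the initial multiplicities are finite:
left and right combs have no tile type in common, so their representations arise from different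
initial supertiles (`producible_of_mem_combination`). But then its image is a stable assembly that
contains both combs in nearly the right relative position, with only `τ - 1` common teeth. No such
assembly exists (`not_stable_of_comb_subset`): a tile bound to a tooth of the left comb drags its
whole row along, and that row collides with the right comb unless it belongs to it.
-/

namespace TwoHAM

/-! ### Assemblies, stability, and combination -/

open Relation

instance : DecidableEq Dir := fun a b => by
  cases a <;> cases b <;> first | exact isTrue rfl | exact isFalse (by intro h; cases h)

instance : Fintype Dir where
  elems := {.north, .east, .south, .west}
  complete d := by cases d <;> simp

theorem Dir.opp_opp (d : Dir) : d.opp.opp = d := by cases d <;> rfl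

theorem Dir.add_vec_opp (p : ℤ × ℤ) (d : Dir) : p + d.vec + d.opp.vec = p := by
  cases d <;> ext <;> simp [Dir.vec, Dir.opp]

theorem Dir.abs_vec (d : Dir) : |d.vec.1| ≤ 1 ∧ |d.vec.2| ≤ 1 := by
  cases d <;> simp [Dir.vec]

section Assemblies

variable {T : Finset TileType}

open Classical in
/-- The strength with which `x` and its neighbour `y` on side `d` interact; either may be
missing. -/
noncomputable def glueBond (x y : Option {t : TileType // t ∈ T}) (d : Dir) : ℕ :=
  match x, y with
  | some s, some t => if s.1.glue d = t.1.glue d.opp then (s.1.glue d).strength else 0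
  | _, _ => 0

theorem Assembly.bond_eq (α : Assembly T) (p : ℤ × ℤ) (d : Dir) :
    α.bond p d = glueBond (α p) (α (p + d.vec)) d := rfl

theorem glueBond_swap (x y : Option {t : TileType // t ∈ T}) (d : Dir) :
    glueBond x y d = glueBond y x d.opp := by
  cases x <;> cases y <;> simp only [glueBond]
  rw [Dir.opp_opp]
  split_ifs with h h' h'
  · rw [h]
  · exact absurd h.symm h'
  · exact absurd h'.symm h
  · rfl

@[simp] theorem glueBond_none_left (y : Option {t : TileType // t ∈ T}) (d : Dir) :
    glueBond none y d = 0 := by cases y <;> rfl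

@[simp] theorem glueBond_none_right (x : Option {t : TileType // t ∈ T}) (d : Dir) :
    glueBond x none d = 0 := by cases x <;> rfl

namespace Assembly

theorem mem_dom {α : Assembly T} {p : ℤ × ℤ} : p ∈ α.dom ↔ α p ≠ none := Iff.rfl

theorem notMem_dom {α : Assembly T} {p : ℤ × ℤ} : p ∉ α.dom ↔ α p = none := by
  simp [dom]

theorem exists_of_mem_dom {α : Assembly T} {p : ℤ × ℤ} (h : p ∈ α.dom) : ∃ t, α p = some t :=
  Option.ne_none_iff_exists'.1 h

theorem mem_dom_of_eq {α : Assembly T} {p : ℤ × ℤ} {t} (h : α p = some t) : p ∈ α.dom := by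
  simp [mem_dom, h]

@[simp] theorem translate_apply (α : Assembly T) (u p : ℤ × ℤ) : α.translate u p = α (p - u) := rfl

theorem translate_zero (α : Assembly T) : α.translate 0 = α := by
  funext p; simp

theorem translate_translate (α : Assembly T) (u v : ℤ × ℤ) :
    (α.translate u).translate v = α.translate (u + v) := by
  funext p; simp only [translate_apply]; congr 1; abel

theorem mem_dom_translate {α : Assembly T} {u p : ℤ × ℤ} :
    p ∈ (α.translate u).dom ↔ p - u ∈ α.dom := Iff.rfl

theorem dom_translate (α : Assembly T) (u : ℤ × ℤ) :
    (α.translate u).dom = (fun p => p + u) '' α.dom := by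
  ext p
  simp [mem_dom_translate, sub_eq_add_neg]

theorem finite_dom_translate {α : Assembly T} (h : α.dom.Finite) (u : ℤ × ℤ) :
    (α.translate u).dom.Finite := by
  rw [dom_translate]
  exact h.image _

theorem translate_union (α β : Assembly T) (u : ℤ × ℤ) :
    (α.union β).translate u = (α.translate u).union (β.translate u) := rfl

theorem supertile_eq_iff {α β : Assembly T} :
    α.supertile = β.supertile ↔ ∃ u, α.translate u = β :=
  ⟨fun h => Quotient.exact (s := assemblySetoid T) h,
    fun h => Quotient.sound (s := assemblySetoid T) h⟩

theorem supertile_translate (α : Assembly T) (u : ℤ × ℤ) :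
    (α.translate u).supertile = α.supertile :=
  (supertile_eq_iff.2 ⟨u, rfl⟩).symm

theorem dom_union (α β : Assembly T) : (α.union β).dom = α.dom ∪ β.dom := by
  ext p
  simp only [dom, union, Set.mem_ofPred_eq, Set.mem_union]
  cases α p <;> simp

theorem union_of_mem {α β : Assembly T} {p : ℤ × ℤ} (h : p ∈ α.dom) : α.union β p = α p := by
  obtain ⟨t, ht⟩ := exists_of_mem_dom h
  simp [union, ht]

theorem union_of_notMem {α β : Assembly T} {p : ℤ × ℤ} (h : p ∉ α.dom) : α.union β p = β p := by
  simp [union, notMem_dom.1 h]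

theorem IsDisjoint.symm {α β : Assembly T} (h : α.IsDisjoint β) : β.IsDisjoint α :=
  Disjoint.symm h

theorem IsDisjoint.notMem {α β : Assembly T} (h : α.IsDisjoint β) {p : ℤ × ℤ} (hp : p ∈ β.dom) :
    p ∉ α.dom := fun hp' => Set.disjoint_left.1 h hp' hp

theorem IsDisjoint.union_comm {α β : Assembly T} (h : α.IsDisjoint β) :
    α.union β = β.union α := by
  funext p
  by_cases hp : p ∈ α.dom
  · rw [union_of_mem hp, union_of_notMem (h.symm.notMem hp)]
  · rw [union_of_notMem hp]
    by_cases hq : p ∈ β.dom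
    · rw [union_of_mem hq]
    · rw [union_of_notMem hq, notMem_dom.1 hp, notMem_dom.1 hq]

theorem IsDisjoint.translate {α β : Assembly T} (h : α.IsDisjoint β) (u : ℤ × ℤ) :
    (α.translate u).IsDisjoint (β.translate u) :=
  Set.disjoint_left.2 fun _ hp hq => Set.disjoint_left.1 h (mem_dom_translate.1 hp)
    (mem_dom_translate.1 hq)

theorem Stable.translate {τ : ℕ} {α : Assembly T} (h : α.Stable τ) (u : ℤ × ℤ) :
    (α.translate u).Stable τ := by
  intro X hX hX'
  have key := h ((fun p => p + u) ⁻¹' X) ?_ ?_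
  · obtain ⟨F, hF, hs⟩ := key
    have hinj : Function.Injective fun e : (ℤ × ℤ) × Dir => (e.1 + u, e.2) := fun e f hef => by
      simp only [Prod.mk.injEq, add_left_inj] at hef
      exact Prod.ext hef.1 hef.2
    refine ⟨F.map ⟨_, hinj⟩, ?_, ?_⟩
    · intro e he
      obtain ⟨f, hf, rfl⟩ := Finset.mem_map.1 he
      have := hF f hf
      refine ⟨this.1, ?_⟩
      have h2 := this.2
      simp only [Set.mem_preimage] at h2
      simp only [Function.Embedding.coeFn_mk]
      rwa [add_right_comm]
    · rw [Finset.sum_map]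
      refine hs.trans (Finset.sum_le_sum fun e _ => le_of_eq ?_)
      simp only [bond_eq, translate_apply, Function.Embedding.coeFn_mk]
      rw [add_sub_cancel_right, add_right_comm, add_sub_cancel_right]
  · obtain ⟨p, hp, hpX⟩ := hX
    exact ⟨p - u, hp, by simpa using hpX⟩
  · obtain ⟨p, hp, hpX⟩ := hX'
    exact ⟨p - u, hp, by simpa using hpX⟩

theorem bond_le_union_left {α β : Assembly T} (p : ℤ × ℤ) (d : Dir) :
    α.bond p d ≤ (α.union β).bond p d := by
  simp only [bond_eq]
  by_cases hp : p ∈ α.dom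
  · by_cases hq : p + d.vec ∈ α.dom
    · rw [union_of_mem hp, union_of_mem hq]
    · simp [notMem_dom.1 hq]
  · simp [notMem_dom.1 hp]

/-- The union of two disjoint stable assemblies that interact with total strength at least `τ` is
stable: a cut either splits one of the two, or it separates them. -/
theorem Stable.union {τ : ℕ} {α β : Assembly T} (hα : α.Stable τ) (hβ : β.Stable τ)
    (hd : α.IsDisjoint β) (F : Finset ((ℤ × ℤ) × Dir))
    (hF : τ ≤ ∑ e ∈ F, glueBond (α e.1) (β (e.1 + e.2.vec)) e.2) :
    (α.union β).Stable τ := by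
  classical
  intro X hX hX'
  by_cases h1 : (α.dom ∩ X).Nonempty ∧ (α.dom \ X).Nonempty
  · obtain ⟨F, h, hs⟩ := hα X h1.1 h1.2
    exact ⟨F, h, hs.trans (Finset.sum_le_sum fun e _ => bond_le_union_left _ _)⟩
  by_cases h2 : (β.dom ∩ X).Nonempty ∧ (β.dom \ X).Nonempty
  · obtain ⟨F, h, hs⟩ := hβ X h2.1 h2.2
    rw [hd.union_comm]
    exact ⟨F, h, hs.trans (Finset.sum_le_sum fun e _ => bond_le_union_left _ _)⟩
  rw [dom_union] at hX hX'
  set P : (ℤ × ℤ) × Dir → Prop := fun e => glueBond (α e.1) (β (e.1 + e.2.vec)) e.2 ≠ 0 with hP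
  have hmem : ∀ e, P e → e.1 ∈ α.dom ∧ e.1 + e.2.vec ∈ β.dom := by
    intro e he
    constructor <;> intro h <;> simp [hP, h] at he
  have hfilter : τ ≤ ∑ e ∈ F.filter P, glueBond (α e.1) (β (e.1 + e.2.vec)) e.2 := by
    rwa [Finset.sum_filter_ne_zero]
  have hbond : ∀ e, P e →
      (α.union β).bond e.1 e.2 = glueBond (α e.1) (β (e.1 + e.2.vec)) e.2 := by
    intro e he
    obtain ⟨ha, hb⟩ := hmem e he
    rw [bond_eq, union_of_mem ha, union_of_notMem (hd.notMem hb)]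
  have hcase : (α.dom ⊆ X ∧ Disjoint β.dom X) ∨ (β.dom ⊆ X ∧ Disjoint α.dom X) := by
    simp only [not_and_or, Set.not_nonempty_iff_eq_empty] at h1 h2
    simp only [Set.disjoint_iff_inter_eq_empty, ← Set.sdiff_eq_empty]
    rw [Set.union_inter_distrib_right] at hX
    rw [Set.union_sdiff_distrib] at hX'
    rcases h1 with h1 | h1 <;> rcases h2 with h2 | h2
    · simp [h1, h2] at hX
    · exact Or.inr ⟨h2, h1⟩
    · exact Or.inl ⟨h1, h2⟩
    · simp [h1, h2] at hX'
  rcases hcase with ⟨ha, hb⟩ | ⟨hb, ha⟩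
  · refine ⟨F.filter P, fun e he => ?_, ?_⟩
    · obtain ⟨h1, h2⟩ := hmem e (Finset.mem_filter.1 he).2
      exact ⟨ha h1, Set.disjoint_left.1 hb h2⟩
    · rwa [Finset.sum_congr rfl fun e he => hbond e (Finset.mem_filter.1 he).2]
  · have hinj : Function.Injective
        fun e : (ℤ × ℤ) × Dir => (e.1 + e.2.vec, e.2.opp) := fun e f hef => by
      simp only [Prod.mk.injEq] at hef
      have h2 : e.2 = f.2 := by rw [← Dir.opp_opp e.2, hef.2, Dir.opp_opp]
      have h1 := hef.1
      rw [h2, add_left_inj] at h1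
      exact Prod.ext h1 h2
    refine ⟨(F.filter P).map ⟨_, hinj⟩, ?_, ?_⟩
    · intro e he
      obtain ⟨f, hf, rfl⟩ := Finset.mem_map.1 he
      obtain ⟨h1, h2⟩ := hmem f (Finset.mem_filter.1 hf).2
      refine ⟨hb h2, ?_⟩
      simp only [Function.Embedding.coeFn_mk, Dir.add_vec_opp]
      exact Set.disjoint_left.1 ha h1
    · rw [Finset.sum_map]
      refine hfilter.trans (Finset.sum_le_sum fun e he => le_of_eq ?_)
      rw [← hbond e (Finset.mem_filter.1 he).2]
      simp only [bond_eq, Function.Embedding.coeFn_mk, Dir.add_vec_opp]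
      rw [glueBond_swap]

/-- In a stable disjoint union the two nonempty parts interact with total strength at least `τ`. -/
theorem Stable.exists_cross {τ : ℕ} {α β : Assembly T} (h : (α.union β).Stable τ)
    (hd : α.IsDisjoint β) (hα : α.dom.Nonempty) (hβ : β.dom.Nonempty) :
    ∃ F : Finset ((ℤ × ℤ) × Dir),
      τ ≤ ∑ e ∈ F, glueBond (α e.1) (β (e.1 + e.2.vec)) e.2 := by
  obtain ⟨p, hp⟩ := hα
  obtain ⟨q, hq⟩ := hβ
  obtain ⟨F, hF, hs⟩ := h α.dom ⟨p, by simp [dom_union, hp], hp⟩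
    ⟨q, by simp [dom_union, hq], hd.notMem hq⟩
  refine ⟨F, hs.trans (Finset.sum_le_sum fun e he => le_of_eq ?_)⟩
  rw [bond_eq, union_of_mem (hF e he).1, union_of_notMem (hF e he).2]

theorem dom_single (t : {t : TileType // t ∈ T}) : (single t).dom = {0} := by
  ext p
  by_cases h : p = 0 <;> simp [dom, single, h]

theorem stable_single (τ : ℕ) (t : {t : TileType // t ∈ T}) : (single t).Stable τ := by
  rintro X ⟨p, hp, hpX⟩ ⟨q, hq, hqX⟩
  rw [dom_single] at hp hq
  rw [Set.mem_singleton_iff] at hp hq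
  subst hp; subst hq
  exact absurd hpX hqX

end Assembly

namespace Supertile

/-- The set of tiles that occur in a supertile. -/
def tileSet : Supertile T → Set {t : TileType // t ∈ T} :=
  Quotient.lift (fun α : Assembly T => {t | ∃ p, α p = some t}) (by
    rintro α _ ⟨u, rfl⟩
    ext t
    constructor
    · rintro ⟨p, hp⟩
      exact ⟨p + u, by simpa using hp⟩
    · rintro ⟨p, hp⟩
      exact ⟨p - u, hp⟩)

/-- The number of tiles of a supertile, with the value `0` for an infinite one. -/
noncomputable def size : Supertile T → ℕ :=
  Quotient.lift (fun α : Assembly T => α.dom.ncard) (by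
    rintro α _ ⟨u, rfl⟩
    rw [Assembly.dom_translate, Set.ncard_image_of_injective _ (add_left_injective u)])

theorem size_supertile (α : Assembly T) : α.supertile.size = α.dom.ncard := rfl

theorem exists_rep (a : Supertile T) : ∃ α : Assembly T, α.supertile = a := Quotient.exists_rep a

end Supertile

theorem combination_comm (τ : ℕ) (a b : Supertile T) : Combination τ a b = Combination τ b a := by
  ext g
  constructor <;> rintro ⟨α, β, ha, hb, hd, hs, hg⟩ <;>
    exact ⟨β, α, hb, ha, hd.symm, hd.union_comm ▸ hs, hd.union_comm ▸ hg⟩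

theorem mem_combination_iff {τ : ℕ} {α β : Assembly T} {g : Supertile T} :
    g ∈ Combination τ α.supertile β.supertile ↔ ∃ δ : ℤ × ℤ, α.IsDisjoint (β.translate δ) ∧
      (α.union (β.translate δ)).Stable τ ∧ (α.union (β.translate δ)).supertile = g := by
  constructor
  · rintro ⟨α', β', ha, hb, hd, hs, hg⟩
    obtain ⟨u, rfl⟩ := Assembly.supertile_eq_iff.1 ha
    obtain ⟨v, rfl⟩ := Assembly.supertile_eq_iff.1 hb.symm
    refine ⟨v + u, ?_, ?_, ?_⟩
    · simpa only [Assembly.translate_translate] using hd.translate u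
    · simpa only [Assembly.translate_union, Assembly.translate_translate] using hs.translate u
    · rw [← hg, ← Assembly.supertile_translate (α'.union _) u, Assembly.translate_union,
        Assembly.translate_translate]
  · rintro ⟨δ, hd, hs, hg⟩
    exact ⟨α, _, rfl, Assembly.supertile_translate β δ, hd, hs, hg⟩

theorem tileSet_subset_of_mem_combination {τ : ℕ} {a b g : Supertile T}
    (h : g ∈ Combination τ a b) : a.tileSet ⊆ g.tileSet := by
  obtain ⟨α, β, rfl, rfl, hd, hs, rfl⟩ := h
  rintro t ⟨p, hp⟩
  exact ⟨p, by rw [Assembly.union_of_mem (Assembly.mem_dom_of_eq hp)]; exact hp⟩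

/-- Attachments from arbitrary states only depend on the combination set: take all multiplicities
infinite. -/
theorem reachesOne_iff {𝒯 : TAS} {a g : Supertile 𝒯.tiles} :
    𝒯.ReachesOne a g ↔ ∃ x, g ∈ Combination 𝒯.temp a x := by
  constructor
  · rintro ⟨S, S', x, h, -⟩
    exact ⟨x, h⟩
  · rintro ⟨x, h⟩
    exact ⟨fun _ => ⊤, fun _ => ⊤, x, h, by simp, by simp, by simp, by simp⟩

theorem tileSet_subset_of_reachesLeOne {𝒯 : TAS} {a g : Supertile 𝒯.tiles}
    (h : 𝒯.ReachesLeOne a g) : a.tileSet ⊆ g.tileSet := by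
  rcases h with rfl | h
  · exact subset_rfl
  · obtain ⟨x, hx⟩ := reachesOne_iff.1 h
    exact tileSet_subset_of_mem_combination hx

end Assemblies

/-! ### Assembly sequences and finite multisets of supertiles -/

section Sequences

variable {T : Finset TileType}

/-- One attachment inside a finite multiset of supertiles, with a product different from both
reactants. -/
def Merge (τ : ℕ) (M N : Multiset (Supertile T)) : Prop :=
  ∃ (a b g : Supertile T) (Q : Multiset (Supertile T)),
    M = a ::ₘ b ::ₘ Q ∧ N = g ::ₘ Q ∧ g ∈ Combination τ a b ∧ g ≠ a ∧ g ≠ b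

open Classical in
/-- The state `S` contains all members of `M`, with multiplicities. -/
def Within (M : Multiset (Supertile T)) (S : State T) : Prop := ∀ w, (M.count w : ℕ∞) ≤ S w

theorem Merge.add_right {τ : ℕ} {M N : Multiset (Supertile T)} (h : Merge τ M N)
    (K : Multiset (Supertile T)) : Merge τ (M + K) (N + K) := by
  obtain ⟨a, b, g, Q, rfl, rfl, h⟩ := h
  exact ⟨a, b, g, Q + K, by simp, by simp, h⟩

theorem reflTransGen_merge_add {τ : ℕ} {M N M' N' : Multiset (Supertile T)}
    (h : ReflTransGen (Merge τ) M N) (h' : ReflTransGen (Merge τ) M' N') :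
    ReflTransGen (Merge τ) (M + M') (N + N') := by
  have h1 : ReflTransGen (Merge τ) (M + M') (N + M') :=
    h.lift (· + M') fun _ _ h => h.add_right _
  have h2 : ReflTransGen (Merge τ) (N + M') (N + N') :=
    h'.lift (N + ·) fun _ _ h => by
      simp only [add_comm N]
      exact h.add_right _
  exact h1.trans h2

/-- What is present after a step is present before it, or arises from what is present before it by
one merger. In the first case the product may be one of the reactants, which requires an infinite
multiplicity or an empty supertile; such a step creates nothing new. -/
theorem within_of_reaction {τ : ℕ} {S S' : State T} {a b g : Supertile T}
    (h : Reaction τ S S' a b g) {Q : Multiset (Supertile T)} (hQ : Within Q S') :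
    Within Q S ∨ ∃ Q', Within Q' S ∧ Merge τ Q' Q := by
  classical
  obtain ⟨hg, hSg, hab, haa, hw⟩ := h
  by_cases hga : g = a ∨ g = b
  · left
    intro w
    refine (hQ w).trans ?_
    by_cases h1 : a = b
    · have h2 := haa h1
      by_cases hwa : w = a
      · rw [hwa, ← h2]; exact le_self_add
      · exact le_of_eq (hw w hwa (h1 ▸ hwa) (by rcases hga with rfl | rfl <;> simp_all))
    · obtain ⟨h2, h3⟩ := hab h1
      by_cases hwa : w = a
      · rw [hwa, ← h2]; exact le_self_add
      by_cases hwb : w = b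
      · rw [hwb, ← h3]; exact le_self_add
      · exact le_of_eq (hw w hwa hwb (by rcases hga with rfl | rfl <;> assumption))
  · push Not at hga
    by_cases hgQ : g ∈ Q
    · right
      obtain ⟨Q, rfl⟩ := Multiset.exists_cons_of_mem hgQ
      refine ⟨a ::ₘ b ::ₘ Q, ?_, a, b, g, Q, rfl, rfl, hg, hga⟩
      intro w
      have hQw := hQ w
      simp only [Multiset.count_cons] at hQw ⊢
      by_cases hwg : w = g
      · subst hwg
        rw [if_neg hga.1, if_neg hga.2]
        rw [hSg, if_pos rfl] at hQw
        push_cast at hQw ⊢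
        simpa using (ENat.add_le_add_iff_right ENat.one_ne_top).1 hQw
      rw [if_neg hwg, add_zero] at hQw
      by_cases h1 : a = b
      · by_cases hwa : w = a
        · rw [hwa, if_pos h1, if_pos rfl, ← haa h1]
          push_cast
          rw [add_assoc, one_add_one_eq_two, ← hwa]
          gcongr
        · rw [if_neg hwa, if_neg (h1 ▸ hwa)]
          simpa [← hw w hwa (h1 ▸ hwa) hwg] using hQw
      · obtain ⟨h2, h3⟩ := hab h1
        by_cases hwa : w = a
        · rw [hwa, if_pos rfl, if_neg h1, ← h2, ← hwa]
          push_cast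
          rw [add_zero]
          gcongr
        by_cases hwb : w = b
        · rw [hwb, if_pos rfl, if_neg (Ne.symm h1), ← h3, ← hwb]
          push_cast
          rw [add_zero]
          gcongr
        · rw [if_neg hwa, if_neg hwb]
          simpa [← hw w hwa hwb hwg] using hQw
    · left
      intro w
      have hQw := hQ w
      by_cases hwg : w = g
      · rw [hwg, Multiset.count_eq_zero.2 hgQ]; simp
      refine hQw.trans ?_
      by_cases h1 : a = b
      · have h2 := haa h1
        by_cases hwa : w = a
        · rw [hwa, ← h2]; exact le_self_add
        · exact le_of_eq (hw w hwa (h1 ▸ hwa) hwg)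
      · obtain ⟨h2, h3⟩ := hab h1
        by_cases hwa : w = a
        · rw [hwa, ← h2]; exact le_self_add
        by_cases hwb : w = b
        · rw [hwb, ← h3]; exact le_self_add
        · exact le_of_eq (hw w hwa hwb hwg)

namespace IsAssemblySequence

variable {τ : ℕ} {k : ℕ∞} {S : ℕ → State T} {α : ℕ → Assembly T}

theorem exists_reaction (h : IsAssemblySequence τ k S α) {i : ℕ}
    (hi : ((i + 1 : ℕ) : ℕ∞) < k) : ∃ a b g, Reaction τ (S i) (S (i + 1)) a b g := by
  rcases h.2.2 i hi with ⟨β, -, -, -, h⟩ | ⟨a, b, g, h, -⟩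
  exacts [⟨_, _, _, h⟩, ⟨_, _, _, h⟩]

theorem lt_of_le {i j : ℕ} (hij : i ≤ j) (hj : (j : ℕ∞) < k) : (i : ℕ∞) < k :=
  lt_of_le_of_lt (by exact_mod_cast hij) hj

theorem ne_zero (h : IsAssemblySequence τ k S α) {i : ℕ} (hi : (i : ℕ∞) < k) :
    S i (α i).supertile ≠ 0 := by
  cases i with
  | zero => exact h.2.1
  | succ i =>
    rcases h.2.2 i hi with ⟨β, -, -, -, h⟩ | ⟨a, b, g, -, h1, h2⟩
    · rw [h.2.1]; simp
    · rwa [h1]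

/-- Whatever finite part of a state is considered, it arises from a finite part of the first state
of the sequence. -/
theorem exists_merge (h : IsAssemblySequence τ k S α) {i : ℕ} (hi : (i : ℕ∞) < k)
    {Q : Multiset (Supertile T)} (hQ : Within Q (S i)) :
    ∃ L, Within L (S 0) ∧ ReflTransGen (Merge τ) L Q := by
  induction i generalizing Q with
  | zero => exact ⟨Q, hQ, .refl⟩
  | succ i ih =>
    obtain ⟨a, b, g, hr⟩ := h.exists_reaction hi
    have hi' := lt_of_le (Nat.le_succ i) hi
    rcases within_of_reaction hr hQ with hQ | ⟨Q', hQ', hm⟩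
    · exact ih hi' hQ
    · obtain ⟨L, hL, hr⟩ := ih hi' hQ'
      exact ⟨L, hL, hr.tail hm⟩

theorem mono (h : IsAssemblySequence τ k S α) {i j : ℕ} (hij : i ≤ j) (hj : (j : ℕ∞) < k) :
    ∀ p ∈ (α i).dom, α j p = α i p := by
  induction j, hij using Nat.le_induction with
  | base => intros; rfl
  | succ j hij ih =>
    intro p hp
    have hj' := lt_of_le (Nat.le_succ j) hj
    rw [← ih hj' p hp]
    rcases h.2.2 j hj with ⟨β, -, he, -, -⟩ | ⟨a, b, g, -, he, -⟩
    · rw [he, Assembly.union_of_mem]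
      rw [Assembly.mem_dom, ih hj' p hp]
      exact hp
    · rw [he]

theorem stable (h : IsAssemblySequence τ k S α) (h0 : (α 0).Stable τ) {i : ℕ}
    (hi : (i : ℕ∞) < k) : (α i).Stable τ := by
  induction i with
  | zero => exact h0
  | succ i ih =>
    rcases h.2.2 i hi with ⟨β, -, -, hs, -⟩ | ⟨a, b, g, -, he, -⟩
    · exact hs
    · rw [he]
      exact ih (lt_of_le (Nat.le_succ i) hi)

/-- A finite result is reached after finitely many steps. -/
theorem exists_eq_result (h : IsAssemblySequence τ k S α) {ω : Assembly T}
    (hr : IsResult k α ω) (hω : ω.dom.Finite) : ∃ i : ℕ, (i : ℕ∞) < k ∧ α i = ω := by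
  have hex : ∀ s ⊆ ω.dom, s.Finite → ∃ i : ℕ, (i : ℕ∞) < k ∧ s ⊆ (α i).dom := by
    intro s hs hfin
    induction s, hfin using Set.Finite.induction_on with
    | empty =>
      refine ⟨0, ?_, by simp⟩
      have h1 := h.1
      exact lt_of_lt_of_le (by simp) h1
    | insert _ _ ih =>
      rename_i p s _ _
      obtain ⟨i, hi, his⟩ := ih ((Set.subset_insert _ _).trans hs)
      have hp : p ∈ ω.dom := hs (Set.mem_insert _ _)
      rw [hr.1] at hp
      obtain ⟨j, hj, hpj⟩ := hp
      have aux : ∀ {i j : ℕ}, i ≤ j → (j : ℕ∞) < k → (α i).dom ⊆ (α j).dom := by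
        intro i j hij hj q hq
        rw [Assembly.mem_dom, h.mono hij hj q hq]
        exact hq
      rcases le_total i j with hij | hij
      · exact ⟨j, hj, Set.insert_subset hpj (his.trans (aux hij hj))⟩
      · exact ⟨i, hi, Set.insert_subset (aux hij hi hpj) his⟩
  obtain ⟨i, hi, hsub⟩ := hex _ subset_rfl hω
  refine ⟨i, hi, ?_⟩
  funext p
  by_cases hp : p ∈ ω.dom
  · exact (hr.2 i hi p (hsub hp)).symm
  · rw [Assembly.notMem_dom.1 hp, ← Assembly.notMem_dom]
    intro hp'
    exact hp (by rw [hr.1]; exact ⟨i, hi, hp'⟩)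

end IsAssemblySequence

theorem exists_merge_of_producible {𝒯 : TAS} {ω : Assembly 𝒯.tiles} (hω : ω.dom.Finite)
    (h : ω.supertile ∈ 𝒯.producible) :
    ∃ L, Within L 𝒯.init ∧ ReflTransGen (Merge 𝒯.temp) L {ω.supertile} := by
  classical
  obtain ⟨k, S, α, ω', h0, hs, hr, hω'⟩ := h
  obtain ⟨u, rfl⟩ := Assembly.supertile_eq_iff.1 hω'.symm
  obtain ⟨i, hi, he⟩ := hs.exists_eq_result hr (Assembly.finite_dom_translate hω u)
  rw [← h0, ← hω', ← he]
  refine hs.exists_merge hi fun w => ?_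
  rw [Multiset.count_singleton]
  split_ifs with hw
  · rw [hw]
    have := hs.ne_zero hi
    simpa [Order.one_le_iff_ne_zero] using this
  · simp

/-- A finite supertile that is reached from a stable one is stable, and it is larger unless it is
the same. -/
theorem reaches_finite {𝒯 : TAS} {α ω : Assembly 𝒯.tiles} (hω : ω.dom.Finite)
    (hα : α.Stable 𝒯.temp) (h : 𝒯.Reaches α.supertile ω.supertile) :
    ω.Stable 𝒯.temp ∧
      (α.supertile = ω.supertile ∨ α.supertile.size < ω.supertile.size) := by
  obtain ⟨k, S, x, ω', hs, hx, hr, hω'⟩ := h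
  obtain ⟨u, rfl⟩ := Assembly.supertile_eq_iff.1 hω'.symm
  have hfin := Assembly.finite_dom_translate hω u
  obtain ⟨i, hi, he⟩ := hs.exists_eq_result hr hfin
  obtain ⟨v, hv⟩ := Assembly.supertile_eq_iff.1 hx.symm
  have hst := hs.stable (hv ▸ hα.translate v) hi
  rw [he] at hst
  have hst' := hst.translate (-u)
  rw [Assembly.translate_translate, add_neg_cancel, Assembly.translate_zero] at hst'
  refine ⟨hst', ?_⟩
  rw [← hω', ← hx, ← he, Supertile.size_supertile, Supertile.size_supertile]
  have hsub : (x 0).dom ⊆ (x i).dom := by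
    intro q hq
    rw [Assembly.mem_dom, hs.mono (Nat.zero_le i) hi q hq]
    exact hq
  rw [← he] at hfin
  rcases hsub.eq_or_ssubset with heq | hlt
  · left
    congr 1
    funext p
    by_cases hp : p ∈ (x 0).dom
    · exact (hs.mono (Nat.zero_le i) hi p hp).symm
    · rw [Assembly.notMem_dom.1 hp, Assembly.notMem_dom.1 (heq ▸ hp : p ∉ (x i).dom)]
  · exact Or.inr (Set.ncard_lt_ncard hlt hfin)

/-- A step of a state sequence together with the supertile that is followed through it. -/
def FollowStep (τ : ℕ) (x y : State T × Assembly T) : Prop :=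
  (∃ β : Assembly T, x.2.IsDisjoint β ∧ y.2 = x.2.union β ∧ y.2.Stable τ ∧
      Reaction τ x.1 y.1 x.2.supertile β.supertile y.2.supertile) ∨
    (∃ a b g : Supertile T, Reaction τ x.1 y.1 a b g ∧ y.2 = x.2 ∧ y.1 x.2.supertile ≠ 0)

theorem exists_seq_of_reflTransGen {X : Type*} {r : X → X → Prop} {x y : X}
    (h : ReflTransGen r x y) :
    ∃ (n : ℕ) (f : ℕ → X), f 0 = x ∧ f n = y ∧ ∀ i < n, r (f i) (f (i + 1)) := by
  induction h with
  | refl => exact ⟨0, fun _ => x, rfl, rfl, by simp⟩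
  | @tail b c _ hbc ih =>
    obtain ⟨n, f, h0, hn, hf⟩ := ih
    refine ⟨n + 1, fun i => if i ≤ n then f i else c, by simp [h0], by simp, ?_⟩
    intro i hi
    rcases Nat.lt_succ_iff_lt_or_eq.1 hi with hi | rfl
    · simpa [hi.le, Nat.succ_le_iff.2 hi] using hf i hi
    · simpa [hn] using hbc

theorem producible_of_followStep {𝒯 : TAS} {x y : State 𝒯.tiles × Assembly 𝒯.tiles}
    (h : ReflTransGen (FollowStep 𝒯.temp) x y) (hx : x.1 = 𝒯.init)
    (h0 : x.1 x.2.supertile ≠ 0) : y.2.supertile ∈ 𝒯.producible := by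
  obtain ⟨n, f, hf0, hfn, hf⟩ := exists_seq_of_reflTransGen h
  have hseq : IsAssemblySequence 𝒯.temp ((n + 1 : ℕ) : ℕ∞) (fun i => (f i).1)
      (fun i => (f i).2) := by
    refine ⟨by simp, by simpa [hf0] using h0, fun i hi => ?_⟩
    have hi' : i < n := by
      have : i + 1 < n + 1 := by exact_mod_cast hi
      omega
    exact hf i hi'
  have hn : ((n : ℕ) : ℕ∞) < ((n + 1 : ℕ) : ℕ∞) := by exact_mod_cast Nat.lt_succ_self n
  have hle : ∀ i : ℕ, (i : ℕ∞) < ((n + 1 : ℕ) : ℕ∞) → i ≤ n := fun i hi => by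
    have : i < n + 1 := by exact_mod_cast hi
    omega
  refine ⟨_, _, _, y.2, by simp [hf0, hx], hseq, ⟨?_, ?_⟩, rfl⟩
  · ext p
    constructor
    · intro hp
      exact ⟨n, hn, by simpa [hfn] using hp⟩
    · rintro ⟨i, hi, hp⟩
      have := hseq.mono (hle i hi) hn p hp
      simp only [hfn] at this
      rw [Assembly.mem_dom, this]
      exact hp
  · intro i hi p hp
    have := hseq.mono (hle i hi) hn p hp
    simpa only [hfn] using this

open Classical in
/-- The state that consists of the multiset `M` and of `F`. -/
noncomputable def stateAdd (M : Multiset (Supertile T)) (F : State T) : State T :=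
  fun w => (M.count w : ℕ∞) + F w

theorem reaction_stateAdd {τ : ℕ} {a b g : Supertile T} (hg : g ∈ Combination τ a b)
    (ha : g ≠ a) (hb : g ≠ b) (Q : Multiset (Supertile T)) (F : State T) :
    Reaction τ (stateAdd (a ::ₘ b ::ₘ Q) F) (stateAdd (g ::ₘ Q) F) a b g := by
  classical
  refine ⟨hg, ?_, fun hab => ⟨?_, ?_⟩, fun hab => ?_, fun w h1 h2 h3 => ?_⟩
  · simp only [stateAdd, Multiset.count_cons, if_neg ha, if_neg hb, if_pos]
    push_cast
    ring
  · simp only [stateAdd, Multiset.count_cons, if_neg ha.symm, if_neg hab, if_pos]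
    push_cast
    ring
  · simp only [stateAdd, Multiset.count_cons, if_neg hb.symm, if_neg (Ne.symm hab),
      if_pos]
    push_cast
    ring
  · subst hab
    simp only [stateAdd, Multiset.count_cons, if_neg ha.symm, if_pos]
    push_cast
    ring
  · simp only [stateAdd, Multiset.count_cons, if_neg h1, if_neg h2, if_neg h3]

/-- Every member of a multiset that arises from initially present supertiles is producible. -/
theorem producible_of_merge {𝒯 : TAS} {L M : Multiset (Supertile 𝒯.tiles)}
    (hL : Within L 𝒯.init) (h : ReflTransGen (Merge 𝒯.temp) L M) {x : Supertile 𝒯.tiles}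
    (hx : x ∈ M) : x ∈ 𝒯.producible := by
  classical
  have hF : ∃ F : State 𝒯.tiles, 𝒯.init = stateAdd L F := by
    choose F hF using fun w => exists_add_of_le (hL w)
    exact ⟨F, funext hF⟩
  obtain ⟨F, hF⟩ := hF
  have hpos : ∀ {M : Multiset (Supertile 𝒯.tiles)} {x}, x ∈ M → stateAdd M F x ≠ 0 := by
    intro M x hx
    have := Multiset.count_pos.2 hx
    simp only [stateAdd, ne_eq, add_eq_zero, Nat.cast_eq_zero, not_and]
    omega
  -- The rest of the initial state is carried along; every member of the current multiset can be
  -- followed back to some initial supertile.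
  have key : ∀ x ∈ M, ∃ α₀ α : Assembly 𝒯.tiles, α.supertile = x ∧
      stateAdd L F α₀.supertile ≠ 0 ∧
      ReflTransGen (FollowStep 𝒯.temp) (stateAdd L F, α₀) (stateAdd M F, α) := by
    clear hx x
    induction h with
    | refl =>
      intro x hx
      obtain ⟨α, rfl⟩ := x.exists_rep
      exact ⟨α, α, rfl, hpos hx, .refl⟩
    | tail _ hm ih =>
      obtain ⟨a, b, g, Q, rfl, rfl, hg, hga, hgb⟩ := hm
      intro x hx
      have hreact := reaction_stateAdd hg hga hgb Q F
      rcases Multiset.mem_cons.1 hx with rfl | hxQ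
      · obtain ⟨α₀, α, ha, h0, hr⟩ := ih a (by simp)
        obtain ⟨β, hb⟩ := b.exists_rep
        rw [← ha, ← hb] at hg
        obtain ⟨δ, hd, hs, hg⟩ := mem_combination_iff.1 hg
        refine ⟨α₀, α.union (β.translate δ), hg, h0,
          hr.tail (Or.inl ⟨β.translate δ, hd, rfl, hs, ?_⟩)⟩
        simp only
        rw [hg, Assembly.supertile_translate, ha, hb]
        exact hreact
      · obtain ⟨α₀, α, ha, h0, hr⟩ := ih x (by simp [hxQ])
        refine ⟨α₀, α, ha, h0, hr.tail (Or.inr ⟨a, b, g, hreact, rfl, ?_⟩)⟩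
        rw [ha]
        exact hpos hx
  obtain ⟨α₀, α, rfl, h0, hr⟩ := key x hx
  exact producible_of_followStep hr hF.symm (by simpa using h0)

end Sequences

/-! ### Production from single tiles -/

section Growth

variable {T : Finset TileType}

open Classical in
/-- The restriction of an assembly to a set of positions. -/
noncomputable def Assembly.restrict (α : Assembly T) (S : Set (ℤ × ℤ)) : Assembly T :=
  fun p => if p ∈ S then α p else none

theorem Assembly.dom_restrict {α : Assembly T} {S : Set (ℤ × ℤ)} (hS : S ⊆ α.dom) :
    (α.restrict S).dom = S := by
  ext p
  by_cases h : p ∈ S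
  · simpa [Assembly.mem_dom, restrict, h] using hS h
  · simp [Assembly.mem_dom, restrict, h]

theorem within_defaultState_single (t : {t : TileType // t ∈ T}) :
    Within {(Assembly.single t).supertile} (defaultState T) := by
  classical
  intro w
  rw [Multiset.count_singleton]
  split_ifs with h
  · rw [defaultState, if_pos ⟨t, h.symm⟩]
    simp
  · simp

theorem within_defaultState_add {M N : Multiset (Supertile T)} (hM : Within M (defaultState T))
    (hN : Within N (defaultState T)) : Within (M + N) (defaultState T) := by
  classical
  intro w
  have h1 := hM w
  have h2 := hN w
  simp only [defaultState] at h1 h2 ⊢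
  rw [Multiset.count_add]
  split_ifs with h
  · simp
  · rw [if_neg h] at h1 h2
    simp only [nonpos_iff_eq_zero, Nat.cast_eq_zero] at h1 h2
    simp [h1, h2]

/-- A finite assembly whose positions are all connected to one of them by bonds of strength at
least `τ` is producible from single tiles: attach the tiles one by one. -/
theorem producible_of_growth {τ : ℕ} {α : Assembly T} (hfin : α.dom.Finite) {p₀ : ℤ × ℤ}
    (hp₀ : p₀ ∈ α.dom)
    (hgrow : ∀ S ⊆ α.dom, p₀ ∈ S →
      (∀ q ∈ S, ∀ d : Dir, q + d.vec ∈ α.dom → τ ≤ α.bond q d → q + d.vec ∈ S) → S = α.dom) :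
    α.supertile ∈ (TAS.mk T (defaultState T) τ).producible := by
  classical
  set good : Set (Set (ℤ × ℤ)) := {S | S ⊆ α.dom ∧ p₀ ∈ S ∧ (α.restrict S).Stable τ ∧
    ∃ L, Within L (defaultState T) ∧ ReflTransGen (Merge τ) L {(α.restrict S).supertile}}
    with hgood
  have hgfin : good.Finite := hfin.finite_subsets.subset fun S hS => hS.1
  have htile : ∀ p t, α p = some t →
      α.restrict {p} = (Assembly.single t).translate p := by
    intro p t ht
    funext q
    by_cases h : q = p
    · subst h; simp [Assembly.restrict, Assembly.single, ht]
    · simp [Assembly.restrict, Assembly.single, h, sub_eq_zero]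
  have hne : good.Nonempty := by
    obtain ⟨t, ht⟩ := Assembly.exists_of_mem_dom hp₀
    refine ⟨{p₀}, by simpa using hp₀, rfl, ?_, _, within_defaultState_single t, ?_⟩
    · rw [htile _ _ ht]
      exact (Assembly.stable_single τ t).translate _
    · rw [htile _ _ ht, Assembly.supertile_translate]
  obtain ⟨S, hS⟩ := hgfin.exists_maximal hne
  obtain ⟨hSα, hpS, hst, L, hL, hr⟩ := hS.1
  have hclosed : S = α.dom := by
    refine hgrow S hSα hpS fun q hq d hd hb => ?_
    by_contra hnot
    obtain ⟨t, ht⟩ := Assembly.exists_of_mem_dom hd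
    set p := q + d.vec with hp
    have hins : insert p S ⊆ α.dom := Set.insert_subset hd hSα
    have hunion : α.restrict (insert p S) =
        (α.restrict S).union ((Assembly.single t).translate p) := by
      funext r
      by_cases hrS : r ∈ S
      · rw [Assembly.union_of_mem (by rwa [Assembly.dom_restrict hSα])]
        simp [Assembly.restrict, hrS]
      · rw [Assembly.union_of_notMem (by rwa [Assembly.dom_restrict hSα]), ← htile _ _ ht]
        simp [Assembly.restrict, hrS]
    have hdisj : (α.restrict S).IsDisjoint ((Assembly.single t).translate p) := by
      rw [Assembly.IsDisjoint, ← htile _ _ ht, Assembly.dom_restrict hSα,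
        Assembly.dom_restrict (by simpa using hd)]
      simpa using hnot
    have hstab : (α.restrict (insert p S)).Stable τ := by
      rw [hunion]
      refine hst.union ((Assembly.stable_single τ t).translate p) hdisj {(q, d)} ?_
      rw [Finset.sum_singleton, ← htile _ _ ht]
      simpa [Assembly.restrict, hq, ← hp, Assembly.bond_eq] using hb
    have hSfin := hfin.subset hSα
    have hsize : (α.restrict (insert p S)).supertile.size = S.ncard + 1 := by
      rw [Supertile.size_supertile, Assembly.dom_restrict hins,
        Set.ncard_insert_of_notMem hnot hSfin]
    have hle : insert p S ≤ S := hS.2 ⟨hins, Set.mem_insert_of_mem _ hpS, hstab,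
      L + {(Assembly.single t).supertile}, within_defaultState_add hL
        (within_defaultState_single t), by
        refine (reflTransGen_merge_add hr .refl).tail
          ⟨(α.restrict S).supertile, (Assembly.single t).supertile, _, 0, rfl, rfl, ?_, ?_, ?_⟩
        · exact mem_combination_iff.2 ⟨p, hdisj, hunion ▸ hstab, hunion ▸ rfl⟩
        · intro h
          have := congrArg Supertile.size h
          rw [hsize, Supertile.size_supertile, Assembly.dom_restrict hSα] at this
          omega
        · intro h
          have := congrArg Supertile.size h
          rw [hsize, Supertile.size_supertile, Assembly.dom_single, Set.ncard_singleton] at this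
          have := (Set.ncard_pos hSfin).2 ⟨_, hpS⟩
          omega⟩ (Set.subset_insert _ _)
    exact hnot (hle (Set.mem_insert _ _))
  have : α.restrict S = α := by
    funext p
    by_cases h : p ∈ S
    · simp [Assembly.restrict, h]
    · rw [hclosed] at h
      simp [Assembly.restrict, Assembly.notMem_dom.1 h]
  rw [this] at hr
  exact producible_of_merge (𝒯 := TAS.mk T (defaultState T) τ) hL hr (by simp)

/-- A producible finite supertile of more than one tile is the product of an attachment of
producible supertiles. -/
theorem exists_combination_of_producible {τ : ℕ} {α : Assembly T} (hfin : α.dom.Finite)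
    (h : α.supertile ∈ (TAS.mk T (defaultState T) τ).producible) (hcard : 1 < α.dom.ncard) :
    ∃ c ∈ (TAS.mk T (defaultState T) τ).producible,
      ∃ d ∈ (TAS.mk T (defaultState T) τ).producible, α.supertile ∈ Combination τ c d := by
  classical
  obtain ⟨L, hL, hr⟩ := exists_merge_of_producible hfin h
  rcases hr.cases_tail with heq | ⟨M, hM, a, b, g, Q, rfl, hN, hg, -, -⟩
  · exfalso
    have h1 := hL α.supertile
    simp only at h1
    rw [← heq, Multiset.count_singleton_self, defaultState] at h1
    split_ifs at h1 with h2
    · obtain ⟨t, ht⟩ := h2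
      have := congrArg Supertile.size ht
      rw [Supertile.size_supertile, Supertile.size_supertile, Assembly.dom_single,
        Set.ncard_singleton] at this
      omega
    · simp at h1
  · rw [Multiset.singleton_eq_cons_iff] at hN
    obtain ⟨rfl, rfl⟩ := hN
    exact ⟨a, producible_of_merge hL hM (by simp), b, producible_of_merge hL hM (by simp), hg⟩

theorem tileSet_nonempty_of_producible {τ : ℕ} {a : Supertile T}
    (h : a ∈ (TAS.mk T (defaultState T) τ).producible) : a.tileSet.Nonempty := by
  classical
  obtain ⟨k, S, α, ω, h0, hs, hr, rfl⟩ := h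
  have h1 := hs.2.1
  rw [h0] at h1
  simp only [defaultState] at h1
  split_ifs at h1 with h2
  · obtain ⟨t, ht⟩ := h2
    obtain ⟨u, hu⟩ := Assembly.supertile_eq_iff.1 ht
    refine ⟨t, u, ?_⟩
    have h3 : α 0 u = some t := by rw [← hu]; simp [Assembly.single]
    rw [hr.2 0 (lt_of_lt_of_le (by simp) hs.1) u (Assembly.mem_dom_of_eq h3), h3]
  · simp at h1

end Growth

/-! ### Tiles of combs -/

section Combs

/-- The kinds of rows of a comb. -/
inductive Kind where
  | bot
  | top
  | short
  | long

instance : DecidableEq Kind := fun a b => by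
  cases a <;> cases b <;> first | exact isTrue rfl | exact isFalse (by intro h; cases h)

instance : Fintype Kind where
  elems := {.bot, .top, .short, .long}
  complete κ := by cases κ <;> simp

/-- The index of the last tile of a row; the tile of index `0` is on the spine. The representation
of a comb by blocks may be off by a few blocks. The body of a comb, formed by the rows of index at
most `100`, is wider than that, and the teeth, which extend to index `1000`, keep the bodies of two
facing combs far apart. -/
def Kind.len : Kind → ℕ
  | .bot => 0
  | .top => 0
  | .short => 100
  | .long => 1000

theorem Kind.len_le (κ : Kind) : κ.len ≤ 1000 := by cases κ <;> simp [Kind.len]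

/-- The direction from the spine to the teeth; `true` stands for left combs, whose teeth point
east, and `false` for right combs, whose teeth point west. -/
def inDir : Bool → Dir
  | true => .east
  | false => .west

/-- Names of glues: the contact glue of the teeth (`none`), the spine glue of either sort of combs,
and a glue for each position between two tiles of a row. -/
abbrev GlueName : Type := Option (Bool × Option (Kind × ℕ))

/-- An injective encoding of glue names by strings. -/
noncomputable def label (x : GlueName) : String :=
  String.ofList (List.replicate (Classical.choose (exists_injective_nat GlueName) x) default)

theorem label_injective : Function.Injective label := by
  intro x y h
  have h1 := congrArg List.length (String.ofList_injective h)
  rw [List.length_replicate, List.length_replicate] at h1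
  exact Classical.choose_spec (exists_injective_nat GlueName) h1

/-- The glue of strength `0`. -/
noncomputable def nullGlue : Glue := ⟨label none, 0⟩

/-- The glue at the tips of the teeth, of strength `1`. -/
noncomputable def contactGlue : Glue := ⟨label none, 1⟩

/-- The glue between the tiles of the spine. -/
noncomputable def spineGlue (τ : ℕ) (s : Bool) : Glue := ⟨label (some (s, none)), τ⟩

/-- The glue between the tiles of index `i` and `i + 1` of a row. -/
noncomputable def rowGlue (τ : ℕ) (s : Bool) (κ : Kind) (i : ℕ) : Glue :=
  ⟨label (some (s, some (κ, i))), τ⟩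

/-- The tile of index `i` in a row of kind `κ` of a comb. -/
noncomputable def combTile (τ : ℕ) (s : Bool) (κ : Kind) (i : ℕ) : TileType where
  glue d :=
    if d = inDir s then
      if i < κ.len then rowGlue τ s κ i else if κ = .long then contactGlue else nullGlue
    else if d = (inDir s).opp then
      if 1 ≤ i then rowGlue τ s κ (i - 1) else nullGlue
    else if d = .north then
      if i = 0 ∧ κ ≠ .top then spineGlue τ s else nullGlue
    else
      if i = 0 ∧ κ ≠ .bot then spineGlue τ s else nullGlue

/-- The tile set of the left and right combs. -/
noncomputable def combTiles (τ : ℕ) : Finset TileType :=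
  (Set.finite_range fun x : Bool × Kind × Fin 1001 =>
    combTile τ x.1 x.2.1 (min x.2.2 x.2.1.len)).toFinset

/-- The tile of index `i` in a row of kind `κ`, as an element of the tile set. Indices beyond the
end of the row are replaced by the last one. -/
noncomputable def rowTile (τ : ℕ) (s : Bool) (κ : Kind) (i : ℕ) :
    {t : TileType // t ∈ combTiles τ} :=
  ⟨combTile τ s κ (min i κ.len), by
    rw [combTiles, Set.Finite.mem_toFinset]
    have := κ.len_le
    exact ⟨(s, κ, ⟨min i κ.len, by omega⟩), by simp⟩⟩

theorem rowTile_val {τ : ℕ} {s : Bool} {κ : Kind} {i : ℕ} (h : i ≤ κ.len) :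
    (rowTile τ s κ i).1 = combTile τ s κ i := by
  simp only [rowTile, min_eq_left h]

theorem exists_eq_rowTile {τ : ℕ} (t : {t : TileType // t ∈ combTiles τ}) :
    ∃ s κ i, i ≤ Kind.len κ ∧ t = rowTile τ s κ i := by
  obtain ⟨t, ht⟩ := t
  have := ht
  rw [combTiles, Set.Finite.mem_toFinset] at this
  obtain ⟨⟨s, κ, i⟩, rfl⟩ := this
  refine ⟨s, κ, min i κ.len, min_le_right _ _, Subtype.ext ?_⟩
  rw [rowTile_val (min_le_right _ _)]

theorem inDir_not (s : Bool) : inDir (!s) = (inDir s).opp := by cases s <;> rfl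

theorem inDir_opp_ne (s : Bool) : (inDir s).opp ≠ inDir s := by
  cases s <;> simp [inDir, Dir.opp]

theorem glue_inDir (τ : ℕ) (s : Bool) (κ : Kind) (i : ℕ) :
    (combTile τ s κ i).glue (inDir s) =
      if i < κ.len then rowGlue τ s κ i else if κ = .long then contactGlue else nullGlue := by
  simp [combTile]

theorem glue_outDir (τ : ℕ) (s : Bool) (κ : Kind) (i : ℕ) :
    (combTile τ s κ i).glue (inDir s).opp =
      if 1 ≤ i then rowGlue τ s κ (i - 1) else nullGlue := by
  simp [combTile, inDir_opp_ne]

theorem glue_north (τ : ℕ) (s : Bool) (κ : Kind) (i : ℕ) :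
    (combTile τ s κ i).glue .north =
      if i = 0 ∧ κ ≠ .top then spineGlue τ s else nullGlue := by
  cases s <;> simp [combTile, inDir, Dir.opp]

theorem glue_south (τ : ℕ) (s : Bool) (κ : Kind) (i : ℕ) :
    (combTile τ s κ i).glue .south =
      if i = 0 ∧ κ ≠ .bot then spineGlue τ s else nullGlue := by
  cases s <;> simp [combTile, inDir, Dir.opp]

/-- The tile whose glue on the side of the teeth is a given row glue is unique. -/
theorem eq_of_glue_eq_rowGlue {τ : ℕ} {s : Bool} {κ : Kind} {i : ℕ}
    {t : {t : TileType // t ∈ combTiles τ}} (h : t.1.glue (inDir s) = rowGlue τ s κ i) :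
    t = rowTile τ s κ i := by
  obtain ⟨s', κ', i', hi, rfl⟩ := exists_eq_rowTile t
  rw [rowTile_val hi] at h
  by_cases hs : s' = s
  · subst hs
    rw [glue_inDir] at h
    split_ifs at h
    · have := label_injective (congrArg Glue.label h)
      simp only [Option.some.injEq, Prod.mk.injEq, true_and] at this
      rw [this.1, this.2]
    · exact absurd (label_injective (congrArg Glue.label h)) (by simp)
    · exact absurd (label_injective (congrArg Glue.label h)) (by simp)
  · exfalso
    obtain rfl : s = !s' := by cases s <;> cases s' <;> simp_all
    rw [inDir_not, glue_outDir] at h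
    split_ifs at h
    · have := label_injective (congrArg Glue.label h)
      simp at this
    · exact absurd (label_injective (congrArg Glue.label h)) (by simp)

/-- The tile whose glue on the side of the teeth is the contact glue is unique. -/
theorem eq_of_glue_eq_contactGlue {τ : ℕ} {s : Bool}
    {t : {t : TileType // t ∈ combTiles τ}} (h : t.1.glue (inDir s) = contactGlue) :
    t = rowTile τ s .long 1000 := by
  obtain ⟨s', κ', i', hi, rfl⟩ := exists_eq_rowTile t
  rw [rowTile_val hi] at h
  by_cases hs : s' = s
  · subst hs
    rw [glue_inDir] at h
    split_ifs at h with h1 h2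
    · exact absurd (label_injective (congrArg Glue.label h)) (by simp)
    · subst h2
      simp only [Kind.len] at h1 hi
      rw [show i' = 1000 by omega]
    · exact absurd (congrArg Glue.strength h) (by simp [nullGlue, contactGlue])
  · exfalso
    obtain rfl : s = !s' := by cases s <;> cases s' <;> simp_all
    rw [inDir_not, glue_outDir] at h
    split_ifs at h
    · exact absurd (label_injective (congrArg Glue.label h)) (by simp)
    · exact absurd (congrArg Glue.strength h) (by simp [nullGlue, contactGlue])

theorem kind_eq_of_rowTile_eq {τ : ℕ} {s s' : Bool} {κ κ' : Kind} {i i' : ℕ}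
    (h : rowTile τ s κ i = rowTile τ s' κ' i') (hs : s = s') (hi : 1 ≤ i) (hi' : 1 ≤ i')
    (hκ : i ≤ κ.len) (hκ' : i' ≤ κ'.len) : κ = κ' ∧ i = i' := by
  subst hs
  have h1 : (combTile τ s κ i).glue (inDir s).opp = (combTile τ s κ' i').glue (inDir s).opp := by
    rw [← rowTile_val hκ, ← rowTile_val hκ', h]
  rw [glue_outDir, glue_outDir, if_pos hi, if_pos hi'] at h1
  have := label_injective (congrArg Glue.label h1)
  simp only [Option.some.injEq, Prod.mk.injEq, true_and] at this
  exact ⟨this.1, by omega⟩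

theorem label_glue_combTile (τ : ℕ) (s : Bool) (κ : Kind) (i : ℕ) (d : Dir) :
    ((combTile τ s κ i).glue d).label = label none ∨
      ∃ x, ((combTile τ s κ i).glue d).label = label (some (s, x)) := by
  simp only [combTile]
  split_ifs <;> first | exact Or.inl rfl | exact Or.inr ⟨_, rfl⟩

theorem exists_label_glue_combTile (τ : ℕ) (s : Bool) (κ : Kind) (i : ℕ) :
    ∃ d x, ((combTile τ s κ i).glue d).label = label (some (s, x)) := by
  by_cases hi : i = 0
  · by_cases hκ : κ = .top
    · refine ⟨.south, none, ?_⟩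
      rw [glue_south, if_pos ⟨hi, by simp [hκ]⟩]
      rfl
    · refine ⟨.north, none, ?_⟩
      rw [glue_north, if_pos ⟨hi, hκ⟩]
      rfl
  · refine ⟨(inDir s).opp, some (κ, i - 1), ?_⟩
    rw [glue_outDir, if_pos (by omega)]
    rfl

theorem side_eq_of_rowTile_eq {τ : ℕ} {s s' : Bool} {κ κ' : Kind} {i i' : ℕ}
    (h : rowTile τ s κ i = rowTile τ s' κ' i') : s = s' := by
  have hv : combTile τ s κ (min i κ.len) = combTile τ s' κ' (min i' κ'.len) :=
    congrArg Subtype.val h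
  obtain ⟨d, x, hx⟩ := exists_label_glue_combTile τ s κ (min i κ.len)
  rw [hv] at hx
  rcases label_glue_combTile τ s' κ' (min i' κ'.len) d with h1 | ⟨y, h1⟩
  · have := label_injective (hx.symm.trans h1)
    simp at this
  · have := label_injective (hx.symm.trans h1)
    simp only [Option.some.injEq, Prod.mk.injEq] at this
    exact this.1

end Combs

/-! ### Combs -/

section CombAssemblies

/-- The index, counted from the spine, of the tiles in column `x` of a comb. The spines of left and
right combs are in the columns `0` and `2001`. -/
def idx : Bool → ℤ → ℤ
  | true, x => x
  | false, x => 2001 - x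

@[simp] theorem idx_idx (s : Bool) (x : ℤ) : idx s (idx s x) = x := by
  cases s <;> simp [idx]

theorem idx_add_vec (s : Bool) (x : ℤ) : idx s x + (inDir s).vec.1 = idx s (x + 1) := by
  cases s <;> simp [idx, inDir, Dir.vec]
  ring

open Classical in
/-- The kind of row `y` in a comb of height `H` whose teeth are in the rows `P`. -/
noncomputable def rowKind (P : Set ℤ) (H y : ℤ) : Kind :=
  if y = 0 then .bot else if y = H then .top else if y ∈ P then .long else .short

/-- The positions of a comb. -/
def combCells (s : Bool) (P : Set ℤ) (H : ℤ) : Set (ℤ × ℤ) :=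
  {p | 0 ≤ p.2 ∧ p.2 ≤ H ∧ 0 ≤ idx s p.1 ∧ idx s p.1 ≤ (rowKind P H p.2).len}

open Classical in
/-- The comb of height `H` with teeth in the rows `P`. -/
noncomputable def comb (τ : ℕ) (s : Bool) (P : Set ℤ) (H : ℤ) : Assembly (combTiles τ) :=
  fun p => if p ∈ combCells s P H then
    some (rowTile τ s (rowKind P H p.2) (idx s p.1).toNat) else none

/-- The rows in `P` are multiples of `1000`, strictly between the bottom and the top row. The gaps
exclude contacts between combs that are not exactly in the right relative position. -/
def Sparse (P : Set ℤ) (H : ℤ) : Prop := ∀ y ∈ P, (1000 : ℤ) ∣ y ∧ 1000 ≤ y ∧ y ≤ H - 1000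

variable {τ : ℕ} {s : Bool} {P Q : Set ℤ} {H : ℤ}

theorem rowKind_of_mem (hP : Sparse P H) {y : ℤ} (hy : y ∈ P) : rowKind P H y = .long := by
  have := hP y hy
  rw [rowKind, if_neg (by omega), if_neg (by omega), if_pos hy]

theorem len_rowKind_le {y : ℤ} (hy : y ∉ P) : (rowKind P H y).len ≤ 100 := by
  rw [rowKind, if_neg hy]
  split_ifs <;> simp [Kind.len]

theorem len_rowKind_of_lt {y : ℤ} (h0 : 0 < y) (hH : y < H) :
    100 ≤ (rowKind P H y).len := by
  rw [rowKind, if_neg (by omega), if_neg (by omega)]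
  split_ifs <;> simp [Kind.len]

theorem mem_of_rowKind_eq {y : ℤ} (h : rowKind P H y = .long) : y ∈ P := by
  rw [rowKind] at h
  split_ifs at h
  assumption

theorem rowKind_ne_top {y : ℤ} (h : y < H) : rowKind P H y ≠ .top := by
  rw [rowKind, if_neg (show y ≠ H by omega)]
  split_ifs <;> simp

theorem rowKind_ne_bot {y : ℤ} (h : 0 < y) : rowKind P H y ≠ .bot := by
  rw [rowKind, if_neg (show y ≠ 0 by omega)]
  split_ifs <;> simp

theorem comb_of_mem {p : ℤ × ℤ} (hp : p ∈ combCells s P H) :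
    comb τ s P H p = some (rowTile τ s (rowKind P H p.2) (idx s p.1).toNat) := by
  rw [comb, if_pos hp]

theorem dom_comb : (comb τ s P H).dom = combCells s P H := by
  ext p
  by_cases h : p ∈ combCells s P H <;> simp [Assembly.mem_dom, comb, h]

theorem mem_combCells {i : ℕ} {j : ℤ} (h0 : 0 ≤ j) (hH : j ≤ H) (hi : i ≤ (rowKind P H j).len) :
    (idx s i, j) ∈ combCells s P H := by
  refine ⟨h0, hH, ?_, ?_⟩ <;> simp only [idx_idx] <;> omega

theorem comb_apply {i : ℕ} {j : ℤ} (h0 : 0 ≤ j) (hH : j ≤ H) (hi : i ≤ (rowKind P H j).len) :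
    comb τ s P H (idx s i, j) = some (rowTile τ s (rowKind P H j) i) := by
  rw [comb_of_mem (mem_combCells h0 hH hi)]
  simp

theorem finite_combCells : (combCells s P H).Finite := by
  refine (Set.finite_Icc ((0, 0) : ℤ × ℤ) (2001, H)).subset ?_
  rintro ⟨x, y⟩ ⟨h0, hH, h1, h2⟩
  have := (rowKind P H y).len_le
  simp only at h0 hH h1 h2
  have : 0 ≤ x ∧ x ≤ 2001 := by
    cases s <;> simp only [idx] at h1 h2 <;> constructor <;> omega
  exact ⟨⟨this.1, h0⟩, ⟨this.2, hH⟩⟩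

theorem bond_of_glue_eq {T : Finset TileType} {α : Assembly T} {p : ℤ × ℤ} {d : Dir}
    {t t' : {t : TileType // t ∈ T}} (h : α p = some t) (h' : α (p + d.vec) = some t')
    (hg : t.1.glue d = t'.1.glue d.opp) : α.bond p d = (t.1.glue d).strength := by
  rw [Assembly.bond_eq, h, h']
  simp [glueBond, hg]

theorem producible_comb (hH : 0 < H) : (comb τ s P H).supertile ∈
    (TAS.mk (combTiles τ) (defaultState (combTiles τ)) τ).producible := by
  refine producible_of_growth (p₀ := (idx s (0 : ℕ), 0)) (dom_comb ▸ finite_combCells)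
    (dom_comb ▸ mem_combCells le_rfl hH.le (Nat.zero_le _)) fun S hS h0 hcl => ?_
  have hspine : ∀ n : ℕ, (n : ℤ) ≤ H → (idx s (0 : ℕ), (n : ℤ)) ∈ S := by
    intro n
    induction n with
    | zero => intro _; simpa using h0
    | succ n ih =>
      intro hn
      push_cast at hn
      have hv : (idx s (0 : ℕ), (n : ℤ)) + Dir.north.vec = (idx s (0 : ℕ), ((n + 1 : ℕ) : ℤ)) := by
        simp [Dir.vec]
      have h1 := hcl _ (ih (by omega)) .north
      rw [hv] at h1
      refine h1 (dom_comb ▸ mem_combCells (by omega) (by push_cast; omega) (Nat.zero_le _)) ?_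
      rw [bond_of_glue_eq (comb_apply (by omega) (by omega) (Nat.zero_le _))
        (hv ▸ comb_apply (by omega) (by push_cast; omega) (Nat.zero_le _))]
      all_goals
        rw [rowTile_val (Nat.zero_le _), glue_north, if_pos ⟨rfl, rowKind_ne_top (by omega)⟩]
      · simp [spineGlue]
      · rw [rowTile_val (Nat.zero_le _)]
        change _ = (combTile _ _ _ _).glue .south
        rw [glue_south, if_pos ⟨rfl, rowKind_ne_bot (by omega)⟩]
  have hrow : ∀ (j : ℤ) (i : ℕ), 0 ≤ j → j ≤ H → i ≤ (rowKind P H j).len → (idx s i, j) ∈ S := by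
    intro j i hj0 hjH
    induction i with
    | zero =>
      intro _
      obtain ⟨n, rfl⟩ := Int.eq_ofNat_of_zero_le hj0
      exact hspine n hjH
    | succ i ih =>
      intro hi
      have hv : (idx s i, j) + (inDir s).vec = (idx s ((i + 1 : ℕ) : ℤ), j) := by
        ext
        · simpa using idx_add_vec s i
        · cases s <;> simp [inDir, Dir.vec]
      have h1 := hcl _ (ih (by omega)) (inDir s)
      rw [hv] at h1
      refine h1 (dom_comb ▸ mem_combCells hj0 hjH hi) ?_
      rw [bond_of_glue_eq (comb_apply hj0 hjH (by omega)) (hv ▸ comb_apply hj0 hjH hi)]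
      all_goals rw [rowTile_val (by omega), glue_inDir, if_pos (by omega)]
      · simp [rowGlue]
      · rw [rowTile_val hi, glue_outDir, if_pos (by omega)]
        simp
  refine hS.antisymm ?_
  rw [dom_comb]
  rintro ⟨x, j⟩ ⟨hj0, hjH, hx0, hx⟩
  have := hrow j (idx s x).toNat hj0 hjH (by simp only at hx; omega)
  simp only at hx0
  rwa [Int.toNat_of_nonneg hx0, idx_idx] at this

theorem stable_of_mem_combination {T : Finset TileType} {τ : ℕ} {α : Assembly T}
    {a b : Supertile T} (h : α.supertile ∈ Combination τ a b) : α.Stable τ := by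
  obtain ⟨β, γ, -, -, -, hs, hg⟩ := h
  obtain ⟨u, rfl⟩ := Assembly.supertile_eq_iff.1 hg
  exact hs.translate u

theorem exists_combination_comb (hH : 0 < H) :
    ∃ c ∈ (TAS.mk (combTiles τ) (defaultState (combTiles τ)) τ).producible,
      ∃ d ∈ (TAS.mk (combTiles τ) (defaultState (combTiles τ)) τ).producible,
        (comb τ s P H).supertile ∈ Combination τ c d := by
  refine exists_combination_of_producible (dom_comb ▸ finite_combCells) (producible_comb hH) ?_
  rw [dom_comb, Set.one_lt_ncard finite_combCells]
  refine ⟨(idx s (0 : ℕ), 0), mem_combCells le_rfl hH.le (Nat.zero_le _), (idx s (0 : ℕ), 1),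
    mem_combCells zero_le_one (by omega) (Nat.zero_le _), by simp⟩

theorem stable_comb (hH : 0 < H) : (comb τ s P H).Stable τ := by
  obtain ⟨c, -, d, -, h⟩ := exists_combination_comb (τ := τ) (s := s) (P := P) hH
  exact stable_of_mem_combination h

theorem isDisjoint_comb : (comb τ true P H).IsDisjoint (comb τ false Q H) := by
  rw [Assembly.IsDisjoint, dom_comb, dom_comb, Set.disjoint_left]
  rintro ⟨x, y⟩ ⟨-, -, h1, h2⟩ ⟨-, -, h3, h4⟩
  have := (rowKind P H y).len_le
  have := (rowKind Q H y).len_le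
  simp only [idx] at h1 h2 h3 h4
  omega

/-- Two combs with at least `τ` common teeth bind. -/
theorem stable_union_comb (hH : 0 < H) (hP : Sparse P H) (hQ : Sparse Q H) {A : Finset ℤ}
    (hA : ∀ y ∈ A, y ∈ P ∧ y ∈ Q) (hcard : τ ≤ A.card) :
    ((comb τ true P H).union (comb τ false Q H)).Stable τ := by
  have hinj : Function.Injective fun y : ℤ => (((1000, y) : ℤ × ℤ), Dir.east) :=
    fun y z h => by simpa using h
  refine (stable_comb hH).union (stable_comb hH) isDisjoint_comb (A.map ⟨_, hinj⟩) ?_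
  rw [Finset.sum_map, Finset.sum_congr rfl (g := fun _ => 1)]
  · simpa using hcard
  · intro y hy
    obtain ⟨hyP, hyQ⟩ := hA y hy
    have h1 := hP y hyP
    have e1 : comb τ true P H (1000, y) = some (rowTile τ true .long 1000) := by
      have := comb_apply (τ := τ) (s := true) (P := P) (H := H) (i := 1000) (j := y) (by omega)
        (by omega) (by rw [rowKind_of_mem hP hyP]; rfl)
      rwa [rowKind_of_mem hP hyP] at this
    have e2 : comb τ false Q H ((1000, y) + Dir.east.vec) =
        some (rowTile τ false .long 1000) := by
      have := comb_apply (τ := τ) (s := false) (P := Q) (H := H) (i := 1000) (j := y) (by omega)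
        (by omega) (by rw [rowKind_of_mem hQ hyQ]; rfl)
      rw [rowKind_of_mem hQ hyQ] at this
      simpa [idx, Dir.vec] using this
    simp only [Function.Embedding.coeFn_mk]
    rw [e1, e2]
    have g1 : (rowTile τ true .long 1000).1.glue .east = contactGlue := by
      rw [rowTile_val (by simp [Kind.len])]
      exact (glue_inDir τ true .long 1000).trans (by simp [Kind.len])
    have g2 : (rowTile τ false .long 1000).1.glue Dir.east.opp = contactGlue := by
      rw [rowTile_val (by simp [Kind.len])]
      exact (glue_inDir τ false .long 1000).trans (by simp [Kind.len])
    simp only [glueBond]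
    rw [if_pos (g1.trans g2.symm), g1]
    rfl

theorem glueBond_le {T : Finset TileType} (t : {t : TileType // t ∈ T})
    (y : Option {t : TileType // t ∈ T}) (d : Dir) :
    glueBond (some t) y d ≤ (t.1.glue d).strength := by
  cases y <;> simp only [glueBond]
  · exact Nat.zero_le _
  · split_ifs
    · exact le_rfl
    · exact Nat.zero_le _

theorem exists_of_glueBond_ne_zero {T : Finset TileType} {t : {t : TileType // t ∈ T}}
    {y : Option {t : TileType // t ∈ T}} {d : Dir} (h : glueBond (some t) y d ≠ 0) :
    ∃ t', y = some t' ∧ t.1.glue d = t'.1.glue d.opp := by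
  cases y with
  | none => simp at h
  | some t' =>
    refine ⟨t', rfl, ?_⟩
    by_contra hne
    simp [glueBond, hne] at h

/-- In a stable assembly a tooth tip of a right comb comes with its whole row: a part of the row
without the next tile would be held by the tip alone, with strength `1`. -/
theorem row_of_tip (hτ : 1 < τ) {G : Assembly (combTiles τ)} (hG : G.Stable τ) {j : ℤ}
    (htip : G (1001, j) = some (rowTile τ false .long 1000)) {q : ℤ × ℤ} (hq : q ∈ G.dom)
    (hq' : q.1 ≤ 1000) (k : ℕ) (hk : k ≤ 1000) :
    G (1001 + k, j) = some (rowTile τ false .long (1000 - k)) := by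
  induction k using Nat.strong_induction_on with
  | _ k ih =>
  obtain rfl | hk0 := Nat.eq_zero_or_pos k
  · simpa using htip
  obtain ⟨k, rfl⟩ : ∃ l, k = l + 1 := ⟨k - 1, by omega⟩
  have hrow : ∀ l : ℕ, l ≤ k → G (1001 + l, j) = some (rowTile τ false .long (1000 - l)) :=
    fun l hl => ih l (by omega) (by omega)
  by_contra hnext
  obtain ⟨F, hF, hs⟩ := hG {p | p.2 = j ∧ 1001 ≤ p.1 ∧ p.1 ≤ 1001 + k}
    ⟨(1001, j), Assembly.mem_dom_of_eq htip, by simp⟩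
    ⟨q, hq, fun h => by have := h.2.1; omega⟩
  have hzero : ∀ e ∈ F, e ≠ ((1001, j), Dir.west) → G.bond e.1 e.2 = 0 := by
    rintro ⟨⟨x, y⟩, d⟩ he hne
    obtain ⟨⟨hy, hx1, hx2⟩, hout⟩ := hF _ he
    simp only at hy hx1 hx2 hout
    subst hy
    obtain ⟨l, rfl⟩ : ∃ l : ℕ, x = 1001 + l := ⟨(x - 1001).toNat, by omega⟩
    have hl : l ≤ k := by omega
    rw [Assembly.bond_eq]
    simp only
    rw [hrow l hl]
    by_contra hb
    have hlen : 1000 - l ≤ Kind.long.len := by simp [Kind.len]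
    have hstr := glueBond_le (rowTile τ false .long (1000 - l)) (G ((1001 + (l : ℤ), y) + d.vec)) d
    obtain ⟨t', ht', hg⟩ := exists_of_glueBond_ne_zero hb
    rw [rowTile_val hlen] at hstr hg
    cases d with
    | north =>
      rw [glue_north, if_neg (by omega)] at hstr
      exact hb (by simpa [nullGlue] using hstr)
    | south =>
      rw [glue_south, if_neg (by omega)] at hstr
      exact hb (by simpa [nullGlue] using hstr)
    | east =>
      have hlk : l = k := by
        by_contra hlk
        exact hout ⟨by simp [Dir.vec], by simp [Dir.vec]; omega, by simp [Dir.vec]; omega⟩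
      subst hlk
      have h1 := glue_outDir τ false .long (1000 - l)
      rw [if_pos (by omega)] at h1
      have h2 := eq_of_glue_eq_rowGlue (s := false) (hg.symm.trans h1)
      apply hnext
      rw [h2] at ht'
      have e1 : ((1001 + (l : ℤ), y) : ℤ × ℤ) + Dir.east.vec = (1001 + ((l + 1 : ℕ) : ℤ), y) := by
        simp [Dir.vec]; ring
      rw [← e1, ht', show 1000 - l - 1 = 1000 - (l + 1) by omega]
    | west =>
      obtain rfl | hl0 := Nat.eq_zero_or_pos l
      · simp at hne
      · exact hout ⟨by simp [Dir.vec], by simp [Dir.vec]; omega, by simp [Dir.vec]; omega⟩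
  have hle : ∑ e ∈ F, G.bond e.1 e.2 ≤ G.bond (1001, j) .west := by
    by_cases hmem : (((1001, j) : ℤ × ℤ), Dir.west) ∈ F
    · rw [Finset.sum_eq_single_of_mem _ hmem hzero]
    · rw [Finset.sum_eq_zero fun e he => hzero e he fun h => hmem (h ▸ he)]
      exact Nat.zero_le _
  have h1 : G.bond (1001, j) .west ≤ 1 := by
    rw [Assembly.bond_eq, htip]
    refine (glueBond_le _ _ _).trans ?_
    rw [rowTile_val (by simp [Kind.len])]
    have := glue_inDir τ false .long 1000
    simp only [inDir] at this
    rw [this]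
    simp [Kind.len, contactGlue]
  omega

/-- Two combs with fewer than `τ` common teeth are not both contained, at nearly the right relative
position, in a stable assembly. -/
theorem not_stable_of_comb_subset (hτ : 1 < τ) {G : Assembly (combTiles τ)} (hG : G.Stable τ)
    (hH : 0 < H) (hP : Sparse P H) (hQ : Sparse Q H)
    (hGP : ∀ p ∈ combCells true P H, G p = comb τ true P H p) {v : ℤ × ℤ}
    (hv₁ : |v.1| ≤ 50) (hv₂ : |v.2| ≤ 50)
    (hGQ : ∀ p ∈ combCells false Q H, G (p + v) = comb τ false Q H p)
    {A : Finset ℤ} (hA : ∀ y, y ∈ P → y ∈ Q → y ∈ A) (hcard : A.card < τ) : False := by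
  classical
  rw [abs_le] at hv₁ hv₂
  have h00 : ((0, 0) : ℤ × ℤ) ∈ combCells true P H :=
    mem_combCells (s := true) (i := 0) le_rfl hH.le (Nat.zero_le _)
  have hdom : ∀ p ∈ combCells true P H, p ∈ G.dom := fun p hp => by
    rw [Assembly.mem_dom, hGP p hp, comb_of_mem hp]; simp
  have hq : ((2001, 0) : ℤ × ℤ) ∈ combCells false Q H := by
    have := mem_combCells (s := false) (P := Q) (i := 0) le_rfl hH.le (Nat.zero_le _)
    simpa [idx] using this
  obtain ⟨F, hF, hs⟩ := hG (combCells true P H) ⟨_, hdom _ h00, h00⟩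
    ⟨(2001, 0) + v, by rw [Assembly.mem_dom, hGQ _ hq, comb_of_mem hq]; simp, fun h => by
      obtain ⟨-, -, -, h⟩ := h
      have := (rowKind P H (((2001, 0) : ℤ × ℤ) + v).2).len_le
      simp only [idx, Prod.fst_add] at h
      omega⟩
  -- Across the cut around the left comb, only its common teeth with the right comb are bound.
  have hbond : ∀ e ∈ F, G.bond e.1 e.2 ≠ 0 →
      G.bond e.1 e.2 ≤ 1 ∧ e = (((1000, e.1.2) : ℤ × ℤ), Dir.east) ∧ e.1.2 ∈ A := by
    rintro ⟨⟨x, j⟩, d⟩ he hb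
    obtain ⟨hin, hout⟩ := hF _ he
    simp only at hin hout hb ⊢
    obtain ⟨hj0, hjH, hx0, hx⟩ := id hin
    simp only [idx] at hj0 hjH hx0 hx
    obtain ⟨i, rfl⟩ := Int.eq_ofNat_of_zero_le hx0
    have hi : i ≤ (rowKind P H j).len := by omega
    have hGp : G ((i : ℤ), j) = some (rowTile τ true (rowKind P H j) i) := by
      rw [hGP _ hin]
      exact comb_apply (s := true) hj0 hjH hi
    rw [Assembly.bond_eq, hGp] at hb ⊢
    have hstr := glueBond_le (rowTile τ true (rowKind P H j) i) (G (((i : ℤ), j) + d.vec)) d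
    obtain ⟨t', ht', hg⟩ := exists_of_glueBond_ne_zero hb
    rw [rowTile_val hi] at hstr hg
    have hnull : ∀ {g : Glue}, g = nullGlue → (combTile τ true (rowKind P H j) i).glue d = g →
        False := by
      rintro g rfl h
      rw [h] at hstr
      exact hb (by simpa [nullGlue] using hstr)
    cases d with
    | north =>
      have h1 := glue_north τ true (rowKind P H j) i
      split_ifs at h1 with h
      · refine absurd ?_ hout
        have hjH' : j ≠ H := by
          rintro rfl
          apply h.2
          rw [rowKind, if_neg (by omega), if_pos rfl]
        have := mem_combCells (s := true) (P := P) (H := H) (i := 0) (j := j + 1) (by omega)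
          (by omega) (Nat.zero_le _)
        simpa [h.1, Dir.vec, idx] using this
      · exact (hnull rfl h1).elim
    | south =>
      have h1 := glue_south τ true (rowKind P H j) i
      split_ifs at h1 with h
      · refine absurd ?_ hout
        have hj0' : j ≠ 0 := by
          rintro rfl
          apply h.2
          rw [rowKind, if_pos rfl]
        have := mem_combCells (s := true) (P := P) (H := H) (i := 0) (j := j - 1) (by omega)
          (by omega) (Nat.zero_le _)
        simpa [h.1, Dir.vec, idx, sub_eq_add_neg] using this
      · exact (hnull rfl h1).elim
    | west =>
      have h1 := glue_outDir τ true (rowKind P H j) i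
      split_ifs at h1 with h
      · refine absurd ?_ hout
        have := mem_combCells (s := true) (P := P) (H := H) (i := i - 1) (j := j) (by omega)
          (by omega) (by omega)
        rw [Nat.cast_sub h] at this
        simpa [Dir.vec, idx, sub_eq_add_neg] using this
      · exact (hnull rfl h1).elim
    | east =>
      have h1 := glue_inDir τ true (rowKind P H j) i
      split_ifs at h1 with h h'
      · refine absurd ?_ hout
        have := mem_combCells (s := true) (P := P) (H := H) (i := i + 1) (j := j) (by omega)
          (by omega) (by omega)
        simpa [Dir.vec, idx] using this
      · have hjP : j ∈ P := mem_of_rowKind_eq h'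
        have hjP' := hP j hjP
        have hi' : i = 1000 := by
          rw [h'] at h hi
          simp only [Kind.len] at h hi
          omega
        subst hi'
        simp only [inDir] at h1
        refine ⟨?_, by simp, ?_⟩
        · rw [h1] at hstr
          exact hstr
        have ht2 : t' = rowTile τ false .long 1000 :=
          eq_of_glue_eq_contactGlue (s := false) (hg.symm.trans h1)
        subst ht2
        have htip : G (1001, j) = some (rowTile τ false .long 1000) := by
          rw [← ht']
          simp [Dir.vec]
        -- The row of the tip passes through the position of the tile of index `100` in the row of
        -- the right comb, and the tile there determines the index and the kind of the row.
        have hlen : 100 ≤ (rowKind Q H (j - v.2)).len :=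
          len_rowKind_of_lt (by omega) (by omega)
        have hr := row_of_tip hτ hG htip (hdom _ h00) (by simp) (900 + v.1).toNat (by omega)
        have hr' := hGQ _ (mem_combCells (s := false) (P := Q) (H := H) (i := 100) (j := j - v.2)
          (by omega) (by omega) hlen)
        rw [comb_apply (by omega) (by omega) hlen] at hr'
        have epos : ((idx false (100 : ℕ), j - v.2) : ℤ × ℤ) + v =
            (1001 + ((900 + v.1).toNat : ℤ), j) := by
          ext
          · simp only [idx, Prod.fst_add]; omega
          · simp
        rw [epos, hr, Option.some_inj] at hr'
        obtain ⟨h2, h3⟩ := kind_eq_of_rowTile_eq hr' rfl (by omega) (by omega)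
          (by simp only [Kind.len]; omega) hlen
        have hjQ : j - v.2 ∈ Q := mem_of_rowKind_eq h2.symm
        have hjQ' := hQ _ hjQ
        have : v.2 = 0 := by omega
        rw [this, sub_zero] at hjQ
        exact hA j hjP hjQ
      · exact (hnull rfl h1).elim
  have hcount : ∑ e ∈ F, G.bond e.1 e.2 ≤ A.card := by
    rw [← Finset.sum_filter_ne_zero]
    calc ∑ e ∈ F with G.bond e.1 e.2 ≠ 0, G.bond e.1 e.2
        ≤ ∑ e ∈ F with G.bond e.1 e.2 ≠ 0, 1 := Finset.sum_le_sum fun e he =>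
          (hbond e (Finset.mem_filter.1 he).1 (Finset.mem_filter.1 he).2).1
      _ = (F.filter fun e => G.bond e.1 e.2 ≠ 0).card := by simp
      _ ≤ A.card := by
        refine Finset.card_le_card_of_injOn (fun e => e.1.2) (fun e he => ?_) ?_
        · rw [Finset.mem_coe, Finset.mem_filter] at he
          exact (hbond e he.1 he.2).2.2
        · intro e he f hf hef
          rw [Finset.mem_coe, Finset.mem_filter] at he hf
          rw [(hbond e he.1 he.2).2.1, (hbond f hf.1 hf.2).2.1]
          simp only at hef
          rw [hef]
  omega

end CombAssemblies

/-! ### Assemblies on the grid of blocks -/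

section Representation

variable {U T : Finset TileType}

theorem ediv_add_ediv_bounds {m : ℤ} (hm : 0 < m) (a b : ℤ) :
    a / m + b / m ≤ (a + b) / m ∧ (a + b) / m ≤ a / m + b / m + 1 := by
  have h1 := Int.mul_ediv_add_emod a m
  have h2 := Int.mul_ediv_add_emod b m
  have h3 := Int.emod_nonneg a hm.ne'
  have h4 := Int.emod_nonneg b hm.ne'
  have h5 := Int.emod_lt_of_pos a hm
  have h6 := Int.emod_lt_of_pos b hm
  constructor
  · rw [Int.le_ediv_iff_mul_le hm]
    nlinarith
  · rw [← Int.lt_add_one_iff, Int.ediv_lt_iff_lt_mul hm]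
    nlinarith

/-- The assembly `α`, shifted by `w`, covers the set `D` in the grid of `m`-blocks up to the
neighbouring blocks: every tile lies in a block at most one block away from `D`, and every block of
`D` carries a tile. -/
def Near (m : ℤ) (w : ℤ × ℤ) (α : Assembly U) (D : Set (ℤ × ℤ)) : Prop :=
  (∀ p ∈ α.dom, ∃ c ∈ D, |(p.1 + w.1) / m - c.1| ≤ 1 ∧ |(p.2 + w.2) / m - c.2| ≤ 1) ∧
  ∀ c ∈ D, ∃ p ∈ α.dom, (p.1 + w.1) / m = c.1 ∧ (p.2 + w.2) / m = c.2

theorem Near.of_translate {m : ℤ} {u w : ℤ × ℤ} {α : Assembly U} {D : Set (ℤ × ℤ)}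
    (h : Near m w (α.translate u) D) : Near m (u + w) α D := by
  refine ⟨fun p hp => ?_, fun c hc => ?_⟩
  · have := h.1 (p + u) (by rw [Assembly.mem_dom_translate]; simpa using hp)
    simpa only [Prod.fst_add, Prod.snd_add, add_assoc] using this
  · obtain ⟨p, hp, h1, h2⟩ := h.2 c hc
    refine ⟨p - u, hp, ?_, ?_⟩
    · rw [← h1]; simp only [Prod.fst_add, Prod.fst_sub]; congr 1; ring
    · rw [← h2]; simp only [Prod.snd_add, Prod.snd_sub]; congr 1; ring

theorem Near.translate {m : ℤ} {w : ℤ × ℤ} {α : Assembly U} {D : Set (ℤ × ℤ)}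
    (h : Near m w α D) : Near m 0 (α.translate w) D := by
  refine Near.of_translate (u := -w) (w := w) ?_ |> fun h' => by simpa using h'
  rwa [Assembly.translate_translate, add_neg_cancel, Assembly.translate_zero]

theorem Near.dom_subset {m : ℤ} (hm : 0 < m) {α : Assembly U} {D : Set (ℤ × ℤ)}
    (h : Near m 0 α D) : α.dom ⊆ ⋃ c ∈ D,
      Set.Icc ((m * (c.1 - 1), m * (c.2 - 1)) : ℤ × ℤ) (m * (c.1 + 2), m * (c.2 + 2)) := by
  intro p hp
  obtain ⟨c, hc, h1, h2⟩ := h.1 p hp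
  simp only [Prod.fst_zero, Prod.snd_zero, add_zero, abs_le] at h1 h2
  have a1 := Int.mul_ediv_add_emod p.1 m
  have a2 := Int.mul_ediv_add_emod p.2 m
  have a3 := Int.emod_nonneg p.1 hm.ne'
  have a4 := Int.emod_nonneg p.2 hm.ne'
  have a5 := Int.emod_lt_of_pos p.1 hm
  have a6 := Int.emod_lt_of_pos p.2 hm
  simp only [Set.mem_iUnion]
  refine ⟨c, hc, ⟨?_, ?_⟩, ⟨?_, ?_⟩⟩ <;> simp only <;> nlinarith

variable {m : ℕ} {R : Block U m → Option {t : TileType // t ∈ T}}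

theorem exists_block_empty {α : Assembly U} (hD : (assemblyRep R α).dom.Finite)
    (h : MapsCleanly R α) :
    ∃ p, p ∉ (assemblyRep R α).dom ∧ ¬ (α.block m p).Nonempty := by
  obtain ⟨B, hB⟩ := (hD.image Prod.fst).bddAbove
  have hlt : ∀ c ∈ (assemblyRep R α).dom, c.1 ≤ B := fun c hc => hB ⟨c, hc, rfl⟩
  rcases h with h | h
  · refine ⟨(B + 2, 0), fun hc => ?_, fun hne => ?_⟩
    · have := hlt _ hc
      simp only at this
      omega
    · obtain ⟨u, v, hu, -, -, hc⟩ := h _ hne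
      have := hlt _ hc
      simp only [Set.mem_insert_iff, Set.mem_singleton_iff] at this hu
      omega
  · by_cases hne : (α.block m (B + 1, 0)).Nonempty
    · refine ⟨(B + 2, 0), fun hc => ?_, fun hne' => ?_⟩
      · have := hlt _ hc
        simp only at this
        omega
      · have := congrArg Prod.fst (h _ _ hne hne')
        simp at this
    · refine ⟨(B + 1, 0), fun hc => ?_, hne⟩
      have := hlt _ hc
      simp only at this
      omega

/-- If some assembly represents a finite one, then the empty block represents no tile. -/
theorem rep_empty {α : Assembly U} (hD : (assemblyRep R α).dom.Finite) (h : MapsCleanly R α) :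
    R (fun _ => none) = none := by
  obtain ⟨p, hp, hb⟩ := exists_block_empty hD h
  rw [Assembly.notMem_dom, assemblyRep] at hp
  rw [← hp]
  congr 1
  funext ij
  by_contra hij
  exact hb ⟨ij, Ne.symm hij⟩

theorem near_of_mapsCleanly (hm : 1 ≤ m) (hR : R (fun _ => none) = none) {α : Assembly U}
    (h : MapsCleanly R α) (hne : (assemblyRep R α).dom.Nonempty) :
    Near m 0 α (assemblyRep R α).dom := by
  have hm' : (0 : ℤ) < m := by omega
  have hblock : ∀ c ∈ (assemblyRep R α).dom, (α.block m c).Nonempty := by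
    intro c hc
    by_contra hb
    apply hc
    rw [assemblyRep, ← hR]
    congr 1
    funext ij
    by_contra hij
    exact hb ⟨ij, hij⟩
  constructor
  · intro p hp
    simp only [Prod.fst_zero, Prod.snd_zero, add_zero]
    have hpb : (α.block m (p.1 / m, p.2 / m)).Nonempty := by
      have h1 := Int.emod_nonneg p.1 hm'.ne'
      have h2 := Int.emod_nonneg p.2 hm'.ne'
      have h3 := Int.emod_lt_of_pos p.1 hm'
      have h4 := Int.emod_lt_of_pos p.2 hm'
      refine ⟨(⟨(p.1 % m).toNat, by omega⟩, ⟨(p.2 % m).toNat, by omega⟩), ?_⟩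
      simp only [Assembly.block]
      rw [Int.toNat_of_nonneg h1, Int.toNat_of_nonneg h2, Int.mul_ediv_add_emod,
        Int.mul_ediv_add_emod]
      exact hp
    rcases h with h | h
    · obtain ⟨u, v, hu, hv, -, hc⟩ := h _ hpb
      refine ⟨_, hc, ?_, ?_⟩
      · rcases hu with rfl | rfl | rfl <;> simp
      · rcases hv with rfl | rfl | rfl <;> simp
    · obtain ⟨c, hc⟩ := hne
      refine ⟨c, hc, ?_, ?_⟩ <;> simp [← h _ _ hpb (hblock c hc)]
  · intro c hc
    obtain ⟨⟨i, j⟩, hij⟩ := hblock c hc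
    refine ⟨_, hij, ?_, ?_⟩
    all_goals
      simp only [Prod.fst_zero, Prod.snd_zero, add_zero]
      rw [Int.mul_add_ediv_left _ _ hm'.ne', Int.ediv_eq_zero_of_lt (by omega) (by omega),
        add_zero]

/-- A supertile rests on the block grid near any assembly in the class of its image. -/
theorem exists_near (hm : 1 ≤ m) (hR : R (fun _ => none) = none)
    {ρ : Supertile U → Supertile T} {Pr : Set (Supertile U)} (hρ : IsSupertileRep R ρ Pr)
    {γ : Assembly U} (hγ : γ.supertile ∈ Pr) {G : Assembly T} (hG : G.supertile = ρ γ.supertile)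
    (hne : G.dom.Nonempty) : ∃ w, Near m w γ G.dom := by
  have hm' : (0 : ℤ) < m := by omega
  obtain ⟨α, hα, hα', hcl⟩ := hρ _ hγ
  obtain ⟨u, rfl⟩ := Assembly.supertile_eq_iff.1 hα.symm
  obtain ⟨e, rfl⟩ := Assembly.supertile_eq_iff.1 (hα'.trans hG.symm)
  have hne' : (assemblyRep R (γ.translate u)).dom.Nonempty := by
    obtain ⟨c, hc⟩ := hne
    exact ⟨c - e, hc⟩
  have h := (near_of_mapsCleanly hm hR hcl hne').of_translate
  rw [add_zero] at h
  refine ⟨u + (m * e.1, m * e.2), fun p hp => ?_, fun c hc => ?_⟩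
  · obtain ⟨c, hc, h1, h2⟩ := h.1 p hp
    refine ⟨c + e, by rw [Assembly.mem_dom_translate]; simpa using hc, ?_, ?_⟩
    · simp only [Prod.fst_add, ← add_assoc]
      rw [Int.add_mul_ediv_left _ _ hm'.ne', add_sub_add_right_eq_sub]
      exact h1
    · simp only [Prod.snd_add, ← add_assoc]
      rw [Int.add_mul_ediv_left _ _ hm'.ne', add_sub_add_right_eq_sub]
      exact h2
  · obtain ⟨p, hp, h1, h2⟩ := h.2 (c - e) hc
    refine ⟨p, hp, ?_, ?_⟩
    · simp only [Prod.fst_add, ← add_assoc]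
      rw [Int.add_mul_ediv_left _ _ hm'.ne', h1]
      simp
    · simp only [Prod.snd_add, ← add_assoc]
      rw [Int.add_mul_ediv_left _ _ hm'.ne', h2]
      simp

theorem Near.embed {m : ℤ} (hm : 0 < m) {w δ : ℤ × ℤ} {α γ : Assembly U} {D E : Set (ℤ × ℤ)}
    (hα : Near m 0 α D) (hγ : Near m w γ E) (h : ∀ p ∈ α.dom, p + δ ∈ γ.dom) :
    ∀ c ∈ D, ∃ g ∈ E, |c.1 + (δ.1 + w.1) / m - g.1| ≤ 2 ∧ |c.2 + (δ.2 + w.2) / m - g.2| ≤ 2 := by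
  intro c hc
  obtain ⟨p, hp, h1, h2⟩ := hα.2 c hc
  simp only [Prod.fst_zero, Prod.snd_zero, add_zero] at h1 h2
  obtain ⟨g, hg, h3, h4⟩ := hγ.1 _ (h p hp)
  refine ⟨g, hg, ?_, ?_⟩
  · have := ediv_add_ediv_bounds hm p.1 (δ.1 + w.1)
    simp only [Prod.fst_add, add_assoc, abs_le] at h3 ⊢
    omega
  · have := ediv_add_ediv_bounds hm p.2 (δ.2 + w.2)
    simp only [Prod.snd_add, add_assoc, abs_le] at h4 ⊢
    omega

theorem Near.cover {m : ℤ} (hm : 0 < m) {w δ p : ℤ × ℤ} {α : Assembly U} {D : Set (ℤ × ℤ)}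
    (hα : Near m 0 α D) (hp : p - δ ∈ α.dom) :
    ∃ c ∈ D, |c.1 + (δ.1 + w.1) / m - (p.1 + w.1) / m| ≤ 2 ∧
      |c.2 + (δ.2 + w.2) / m - (p.2 + w.2) / m| ≤ 2 := by
  obtain ⟨c, hc, h1, h2⟩ := hα.1 _ hp
  refine ⟨c, hc, ?_, ?_⟩
  · have := ediv_add_ediv_bounds hm (p.1 - δ.1) (δ.1 + w.1)
    rw [show p.1 - δ.1 + (δ.1 + w.1) = p.1 + w.1 by ring] at this
    simp only [Prod.fst_zero, add_zero, Prod.fst_sub, abs_le] at h1 ⊢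
    omega
  · have := ediv_add_ediv_bounds hm (p.2 - δ.2) (δ.2 + w.2)
    rw [show p.2 - δ.2 + (δ.2 + w.2) = p.2 + w.2 by ring] at this
    simp only [Prod.snd_zero, add_zero, Prod.snd_sub, abs_le] at h2 ⊢
    omega

end Representation

section Location

variable {s : Bool} {P Q : Set ℤ} {H : ℤ}

theorem combCells_bounds {p : ℤ × ℤ} (hp : p ∈ combCells s P H) :
    0 ≤ p.2 ∧ p.2 ≤ H ∧ 0 ≤ idx s p.1 ∧ idx s p.1 ≤ 1000 ∧ (p.2 ∉ P → idx s p.1 ≤ 100) := by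
  obtain ⟨h1, h2, h3, h4⟩ := hp
  refine ⟨h1, h2, h3, ?_, fun h => ?_⟩
  · have := (rowKind P H p.2).len_le
    omega
  · have := len_rowKind_le (H := H) h
    omega

/-- A comb cannot be moved far and still stay close to its union with a comb of the other sort. -/
theorem abs_le_of_comb_near (hP : Sparse P H) (hQ : Sparse Q H) (hne : P.Nonempty) {B : ℤ}
    (hB0 : 0 ≤ B) (hB : B ≤ 40) {t u : ℤ × ℤ} (ht₁ : |t.1| ≤ B) (ht₂ : |t.2| ≤ B)
    (h : ∀ c ∈ combCells s P H, ∃ g, (g ∈ combCells s P H ∨ g - t ∈ combCells (!s) Q H) ∧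
      |c.1 + u.1 - g.1| ≤ 2 ∧ |c.2 + u.2 - g.2| ≤ 2) :
    |u.1| ≤ B + 2 ∧ |u.2| ≤ B + 2 := by
  obtain ⟨j, hj⟩ := hne
  have hjP := hP j hj
  obtain ⟨g₁, hg₁, h1⟩ := h (idx s (0 : ℕ), 0)
    (mem_combCells le_rfl (by omega) (Nat.zero_le _))
  obtain ⟨g₂, hg₂, h2⟩ := h (idx s (0 : ℕ), H)
    (mem_combCells (by omega) le_rfl (Nat.zero_le _))
  obtain ⟨g₃, hg₃, h3⟩ := h (idx s (100 : ℕ), 500)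
    (mem_combCells (by omega) (by omega) (len_rowKind_of_lt (by omega) (by omega)))
  obtain ⟨g₄, hg₄, h4⟩ := h (idx s (1000 : ℕ), j)
    (mem_combCells (by omega) (by omega) (by rw [rowKind_of_mem hP hj]; rfl))
  have hb : ∀ g, (g ∈ combCells s P H ∨ g - t ∈ combCells (!s) Q H) →
      -B ≤ g.2 ∧ g.2 ≤ H + B ∧ -B ≤ idx s g.1 ∧ idx s g.1 ≤ 2001 + B := by
    intro g hg
    rw [abs_le] at ht₁ ht₂
    rcases hg with hg | hg <;> have := combCells_bounds hg <;> cases s <;>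
      simp only [idx, Bool.not_true, Bool.not_false, Prod.fst_sub, Prod.snd_sub] at this ⊢ <;>
      omega
  have hb₁ := hb _ hg₁
  have hb₂ := hb _ hg₂
  have hb₄ := hb _ hg₄
  clear hb
  rw [abs_le] at ht₁ ht₂
  simp only [abs_le] at h1 h2 h3 h4 ⊢
  -- Rows `400` to `600` have no teeth, so there only the bodies of the combs are present.
  have hno : ∀ {P : Set ℤ}, Sparse P H → ∀ y : ℤ, 400 ≤ y → y ≤ 600 → y ∉ P := by
    intro P hP y h1 h2 hy
    have := hP y hy
    omega
  have hb₃ : idx s g₃.1 ≤ 100 ∨ 2001 - 100 - B ≤ idx s g₃.1 := by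
    rcases hg₃ with hg | hg
    · exact Or.inl ((combCells_bounds hg).2.2.2.2 (hno hP _ (by omega) (by omega)))
    · have := (combCells_bounds hg).2.2.2.2 (hno hQ _ (by simp only [Prod.snd_sub]; omega)
        (by simp only [Prod.snd_sub]; omega))
      right
      cases s <;> simp only [idx, Bool.not_true, Bool.not_false, Prod.fst_sub] at this ⊢ <;> omega
  cases s <;> simp only [idx] at h1 h2 h3 h4 hb₁ hb₂ hb₃ hb₄ <;> omega

end Location

/-! ### Contacts at teeth, and pigeonhole arguments -/

section Windows

variable {U : Finset TileType}

/-- The positions that are compared around a tooth, relative to the south-west corner of the block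
of index `0` in its row. -/
noncomputable def windowBox (m : ℕ) : Finset (ℤ × ℤ) :=
  Finset.Icc (-10 * m, -10 * m) (1010 * m, 10 * m)

/-- The part of the assembly `α` around row `j` of blocks. -/
def window (m : ℕ) (α : Assembly U) (j : ℤ) (o : {o : ℤ × ℤ // o ∈ windowBox m}) :
    Option {t : TileType // t ∈ U} :=
  α (o.1 + (0, m * j))

/-- The edges at which a left and a right comb can touch at the tooth in row `j`. -/
noncomputable def slabEdges (m : ℕ) (j : ℤ) : Finset ((ℤ × ℤ) × Dir) :=
  Finset.Icc ((-m, m * j - m) : ℤ × ℤ) (1002 * m, m * j + 2 * m) ×ˢ Finset.univ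

/-- The strength of the interaction of `α` and `β`, shifted by `δ`, at the tooth in row `j`. -/
noncomputable def slab (m : ℕ) (α β : Assembly U) (δ : ℤ × ℤ) (j : ℤ) : ℕ :=
  ∑ e ∈ slabEdges m j, glueBond (α e.1) (β.translate δ (e.1 + e.2.vec)) e.2

theorem eq_of_window_eq {m : ℕ} {α α' : Assembly U} {j j' : ℤ}
    (h : window m α j = window m α' j') {p : ℤ × ℤ} (h₁ : -10 * m ≤ p.1) (h₂ : p.1 ≤ 1010 * m)
    (h₃ : m * j - 10 * m ≤ p.2) (h₄ : p.2 ≤ m * j + 10 * m) :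
    α p = α' (p + (0, m * j' - m * j)) := by
  have hmem : (p - (0, m * j) : ℤ × ℤ) ∈ windowBox m := by
    rw [windowBox, Finset.mem_Icc]
    constructor <;> constructor <;> simp <;> omega
  have := congrFun h ⟨_, hmem⟩
  simp only [window] at this
  rw [sub_add_cancel] at this
  rw [this]
  congr 1
  ext <;> simp
  ring

theorem slab_eq_of_window_eq {m : ℕ} (hm : 1 ≤ m) {α β α' β' : Assembly U} {δ : ℤ × ℤ}
    {j j' : ℤ} (hδ₁ : |δ.1| ≤ 5 * m) (hδ₂ : |δ.2| ≤ 5 * m)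
    (hα : window m α j = window m α' j') (hβ : window m β j = window m β' j') :
    slab m α β δ j = slab m α' β' δ j' := by
  rw [abs_le] at hδ₁ hδ₂
  refine Finset.sum_bij' (fun e _ => (e.1 + (0, m * j' - m * j), e.2))
    (fun e _ => (e.1 - (0, m * j' - m * j), e.2)) ?_ ?_ ?_ ?_ ?_
  · rintro ⟨⟨x, y⟩, d⟩ he
    simp only [slabEdges, Finset.mem_product, Finset.mem_Icc, Prod.mk_le_mk, Finset.mem_univ,
      and_true, Prod.mk_add_mk] at he ⊢
    omega
  · rintro ⟨⟨x, y⟩, d⟩ he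
    simp only [slabEdges, Finset.mem_product, Finset.mem_Icc, Prod.mk_le_mk, Finset.mem_univ,
      and_true, Prod.mk_sub_mk] at he ⊢
    omega
  · intro e _; simp
  · intro e _; simp
  · rintro ⟨⟨x, y⟩, d⟩ he
    simp only [slabEdges, Finset.mem_product, Finset.mem_Icc, Prod.mk_le_mk, Finset.mem_univ,
      and_true] at he
    have hd := d.abs_vec
    rw [abs_le, abs_le] at hd
    rw [eq_of_window_eq hα (p := (x, y)) (by simp only; omega) (by simp only; omega)
      (by simp only; omega) (by simp only; omega)]
    simp only [Assembly.translate_apply]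
    rw [eq_of_window_eq hβ (p := (x, y) + d.vec - δ)
      (by simp only [Prod.fst_add, Prod.fst_sub]; omega)
      (by simp only [Prod.fst_add, Prod.fst_sub]; omega)
      (by simp only [Prod.snd_add, Prod.snd_sub]; omega)
      (by simp only [Prod.snd_add, Prod.snd_sub]; omega)]
    congr 2
    ext <;> simp
    ring

variable {P Q : Set ℤ} {H : ℤ}

/-- Representations of a left and a right comb in nearly the right relative position touch or
overlap only near common teeth. -/
theorem exists_row_of_touch {m : ℕ} (hm : 1 ≤ m) {α β : Assembly U} (hP : Sparse P H)
    (hQ : Sparse Q H) (hα : Near m 0 α (combCells true P H))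
    (hβ : Near m 0 β (combCells false Q H)) {δ : ℤ × ℤ} (hδ₁ : |δ.1| ≤ 5 * m)
    (hδ₂ : |δ.2| ≤ 5 * m) {p q : ℤ × ℤ} (hp : p ∈ α.dom) (hq : q ∈ (β.translate δ).dom)
    (h₁ : |q.1 - p.1| ≤ 1) (h₂ : |q.2 - p.2| ≤ 1) :
    ∃ j ∈ P, j ∈ Q ∧ -m ≤ p.1 ∧ p.1 ≤ 1002 * m ∧ m * j - m ≤ p.2 ∧ p.2 ≤ m * j + 2 * m := by
  have hm' : (0 : ℤ) < m := by omega
  rw [abs_le] at hδ₁ hδ₂ h₁ h₂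
  obtain ⟨c, hc, hc1, hc2⟩ := hα.1 p hp
  obtain ⟨g, hg, hg1, hg2⟩ := hβ.1 _ (Assembly.mem_dom_translate.1 hq)
  simp only [Prod.fst_zero, Prod.snd_zero, add_zero, Prod.fst_sub, Prod.snd_sub, abs_le]
    at hc1 hc2 hg1 hg2
  have hdiff : ∀ a b : ℤ, -(6 * m) ≤ b - a → b - a ≤ 6 * m →
      -7 ≤ b / m - a / m ∧ b / m - a / m ≤ 7 := by
    intro a b h1 h2
    have h3 := ediv_add_ediv_bounds hm' a (b - a)
    rw [add_sub_cancel] at h3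
    have h4 : (b - a) / m ≤ 6 := Int.ediv_le_of_le_mul hm' h2
    have h5 : -6 ≤ (b - a) / m := by
      rw [Int.le_ediv_iff_mul_le hm']
      linarith
    omega
  have d1 := hdiff p.1 (q.1 - δ.1) (by omega) (by omega)
  have d2 := hdiff p.2 (q.2 - δ.2) (by omega) (by omega)
  have bc := combCells_bounds hc
  have bg := combCells_bounds hg
  simp only [idx] at bc bg
  have hcP : c.2 ∈ P := by
    by_contra h
    have := bc.2.2.2.2 h
    omega
  have hgQ : g.2 ∈ Q := by
    by_contra h
    have := bg.2.2.2.2 h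
    omega
  have h5 := hP _ hcP
  have h6 := hQ _ hgQ
  have h7 : c.2 = g.2 := by omega
  have a1 := Int.mul_ediv_add_emod p.1 m
  have a2 := Int.mul_ediv_add_emod p.2 m
  have a3 := Int.emod_nonneg p.1 hm'.ne'
  have a4 := Int.emod_nonneg p.2 hm'.ne'
  have a5 := Int.emod_lt_of_pos p.1 hm'
  have a6 := Int.emod_lt_of_pos p.2 hm'
  refine ⟨c.2, hcP, h7 ▸ hgQ, ?_, ?_, ?_, ?_⟩ <;> nlinarith

theorem disjoint_slabEdges {m : ℕ} (hm : 1 ≤ m) {i j : ℤ} (hi : (1000 : ℤ) ∣ i)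
    (hj : (1000 : ℤ) ∣ j) (hij : i ≠ j) : Disjoint (slabEdges m i) (slabEdges m j) := by
  rw [Finset.disjoint_left]
  rintro ⟨⟨x, y⟩, d⟩ h h'
  simp only [slabEdges, Finset.mem_product, Finset.mem_Icc, Prod.mk_le_mk, Finset.mem_univ,
    and_true] at h h'
  rcases lt_or_gt_of_ne hij with hlt | hlt
  · have : i + 1000 ≤ j := by omega
    nlinarith
  · have : j + 1000 ≤ i := by omega
    nlinarith

theorem sum_biUnion_slabEdges {m : ℕ} (hm : 1 ≤ m) {A : Finset ℤ}
    (hA : ∀ j ∈ A, (1000 : ℤ) ∣ j) (α β : Assembly U) (δ : ℤ × ℤ) :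
    ∑ e ∈ A.biUnion (slabEdges m), glueBond (α e.1) (β.translate δ (e.1 + e.2.vec)) e.2 =
      ∑ j ∈ A, slab m α β δ j :=
  Finset.sum_biUnion fun i hi j hj hij => disjoint_slabEdges hm (hA i hi) (hA j hj) hij

/-- The strength of the whole interaction is at most the sum of those at the common teeth. -/
theorem cross_le_sum_slab {m : ℕ} (hm : 1 ≤ m) {α β : Assembly U} (hP : Sparse P H)
    (hQ : Sparse Q H) (hα : Near m 0 α (combCells true P H))
    (hβ : Near m 0 β (combCells false Q H)) {δ : ℤ × ℤ} (hδ₁ : |δ.1| ≤ 5 * m)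
    (hδ₂ : |δ.2| ≤ 5 * m) {A : Finset ℤ} (hA : ∀ j ∈ A, (1000 : ℤ) ∣ j)
    (hPQ : ∀ j ∈ P, j ∈ Q → j ∈ A) (F : Finset ((ℤ × ℤ) × Dir)) :
    ∑ e ∈ F, glueBond (α e.1) (β.translate δ (e.1 + e.2.vec)) e.2 ≤
      ∑ j ∈ A, slab m α β δ j := by
  classical
  rw [← sum_biUnion_slabEdges hm hA, ← Finset.sum_filter_ne_zero]
  refine Finset.sum_le_sum_of_subset ?_
  rintro ⟨p, d⟩ he
  have he := (Finset.mem_filter.1 he).2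
  have hp : p ∈ α.dom := fun h => he (by simp [h])
  have hq : p + d.vec ∈ (β.translate δ).dom := fun h => he (by simp only [h, glueBond_none_right])
  have hd := d.abs_vec
  obtain ⟨j, hj, hj', h1, h2, h3, h4⟩ := exists_row_of_touch hm hP hQ hα hβ hδ₁ hδ₂ hp hq
    (by simpa using hd.1) (by simpa using hd.2)
  refine Finset.mem_biUnion.2 ⟨j, hPQ j hj hj', ?_⟩
  simp only [slabEdges, Finset.mem_product, Finset.mem_Icc, Finset.mem_univ, and_true]
  exact ⟨⟨h1, h3⟩, ⟨h2, h4⟩⟩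

/-- If two representations bind at `τ` common teeth that all look alike, and `τ'` is not of the
form that admits a uniform mapping, then removing one of these teeth does not prevent binding. -/
theorem stable_of_fewer_teeth {τ τ' m : ℕ} (hm : 1 ≤ m)
    (hττ' : ∀ c : ℕ, τ' ≤ τ * c → τ' ≤ (τ - 1) * c)
    {α β β' : Assembly U} {Q' : Set ℤ} (hP : Sparse P H) (hQ : Sparse Q H) (hQ' : Sparse Q' H)
    (hα : Near m 0 α (combCells true P H)) (hβ : Near m 0 β (combCells false Q H))
    (hβ' : Near m 0 β' (combCells false Q' H)) (hαs : α.Stable τ') (hβs : β'.Stable τ')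
    {δ : ℤ × ℤ} (hδ₁ : |δ.1| ≤ 5 * m) (hδ₂ : |δ.2| ≤ 5 * m) {A A' : Finset ℤ}
    (hA : ∀ j, j ∈ A ↔ j ∈ P ∧ j ∈ Q) (hA' : ∀ j, j ∈ A' ↔ j ∈ P ∧ j ∈ Q') (hsub : A' ⊆ A)
    (hcard : A.card = τ) (hcard' : A'.card = τ - 1) {j₀ : ℤ}
    (hwα : ∀ j ∈ A, window m α j = window m α j₀) (hwβ : ∀ j ∈ A, window m β j = window m β j₀)
    (hwβ' : ∀ j ∈ A', window m β' j = window m β j)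
    (hd : α.IsDisjoint (β.translate δ)) (hs : (α.union (β.translate δ)).Stable τ')
    (hαne : α.dom.Nonempty) (hβne : β.dom.Nonempty) :
    α.IsDisjoint (β'.translate δ) ∧ (α.union (β'.translate δ)).Stable τ' := by
  have hdvd : ∀ j ∈ A, (1000 : ℤ) ∣ j := fun j hj => (hP j ((hA j).1 hj).1).1
  obtain ⟨F, hF⟩ := hs.exists_cross hd hαne (by
    obtain ⟨p, hp⟩ := hβne
    exact ⟨p + δ, by rw [Assembly.mem_dom_translate]; simpa using hp⟩)
  have h1 := hF.trans (cross_le_sum_slab hm hP hQ hα hβ hδ₁ hδ₂ hdvd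
    (fun j h h' => (hA j).2 ⟨h, h'⟩) F)
  rw [Finset.sum_congr rfl fun j hj =>
    slab_eq_of_window_eq hm hδ₁ hδ₂ (hwα j hj) (hwβ j hj), Finset.sum_const, hcard,
    smul_eq_mul] at h1
  have h2 := hττ' _ h1
  have hd' : α.IsDisjoint (β'.translate δ) := by
    refine Set.disjoint_left.2 fun p hp hq => ?_
    obtain ⟨j, hj, hj', h3, h4, h5, h6⟩ := exists_row_of_touch hm hP hQ' hα hβ' hδ₁ hδ₂ hp hq
      (by simp) (by simp)
    have hjA : j ∈ A' := (hA' j).2 ⟨hj, hj'⟩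
    refine Set.disjoint_left.1 hd hp ?_
    rw [abs_le] at hδ₁ hδ₂
    have h7 := eq_of_window_eq (hwβ' j hjA) (p := p - δ)
      (by simp only [Prod.fst_sub]; omega) (by simp only [Prod.fst_sub]; omega)
      (by simp only [Prod.snd_sub]; omega) (by simp only [Prod.snd_sub]; omega)
    rw [sub_self, Prod.mk_zero_zero, add_zero] at h7
    rw [Assembly.mem_dom_translate, Assembly.mem_dom] at hq ⊢
    rwa [← h7]
  refine ⟨hd', hαs.union (hβs.translate δ) hd' (A'.biUnion (slabEdges m)) ?_⟩
  rw [sum_biUnion_slabEdges hm fun j hj => hdvd j (hsub hj), Finset.sum_congr rfl fun j hj =>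
    (slab_eq_of_window_eq hm hδ₁ hδ₂ rfl (hwβ' j hj)).trans
      (slab_eq_of_window_eq hm hδ₁ hδ₂ (hwα j (hsub hj)) (hwβ j (hsub hj))),
    Finset.sum_const, hcard', smul_eq_mul]
  exact h2

end Windows

section Boxes

/-- A finite colouring of the grid points of `ℕ^K` is constant on the vertices of some box, whose
size does not depend on the colouring. -/
theorem exists_monochromatic_box (K : ℕ) : ∀ (C : Type) [Finite C], ∃ q : ℕ,
    ∀ f : (Fin K → ℕ) → C, ∃ y z : Fin K → ℕ, (∀ k, y k < q ∧ z k < q ∧ y k ≠ z k) ∧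
      ∀ w, (∀ k, w k = y k ∨ w k = z k) → f w = f y := by
  induction K with
  | zero =>
    intro C _
    exact ⟨0, fun f => ⟨0, 0, fun k => k.elim0, fun w _ => by rw [Subsingleton.elim w 0]⟩⟩
  | succ K ih =>
    intro C _
    obtain ⟨q, hq⟩ := ih (Fin (Nat.card C + 1) → C)
    refine ⟨max q (Nat.card C + 1), fun f => ?_⟩
    obtain ⟨y, z, hyz, hw⟩ := hq fun v i => f (Fin.cons i v)
    obtain ⟨i, i', hii', hf⟩ : ∃ i i' : Fin (Nat.card C + 1), i ≠ i' ∧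
        f (Fin.cons i y) = f (Fin.cons i' y) := by
      by_contra! hcon
      have hinj : Function.Injective fun i : Fin (Nat.card C + 1) =>
          f (Fin.cons (i : ℕ) y) := fun i i' h => by
        by_contra hne
        exact hcon i i' hne h
      have := Nat.card_le_card_of_injective _ hinj
      simp at this
    refine ⟨Fin.cons i y, Fin.cons i' z, fun k => ?_, fun w hwk => ?_⟩
    · refine Fin.cases ?_ (fun k => ?_) k
      · simp only [Fin.cons_zero]
        have h1 := i.2
        have h2 := i'.2
        refine ⟨by omega, by omega, fun h => hii' (Fin.ext h)⟩
      · have := hyz k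
        simp only [Fin.cons_succ]
        refine ⟨by omega, by omega, this.2.2⟩
    · have htail := hw (Fin.tail w) fun k => by
        have := hwk k.succ
        simpa only [Fin.cons_succ] using! this
      have h0 := hwk 0
      simp only [Fin.cons_zero] at h0
      rw [← Fin.cons_self_tail w]
      rcases h0 with h0 | h0 <;> rw [h0]
      · exact congrFun htail i
      · exact (congrFun htail i').trans hf.symm

/-- Without a uniform mapping, no `c` separates `τ` contacts of strength `c` from `τ - 1` ones. -/
theorem le_mul_of_not_hasUniformMapping {τ τ' : ℕ} (hτ : 0 < τ) (hτ' : 0 < τ')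
    (hM : ¬ HasUniformMapping τ τ') (c : ℕ) (hc : τ' ≤ τ * c) : τ' ≤ (τ - 1) * c := by
  by_contra! hlt
  have hc0 : 0 < c := by
    rcases Nat.eq_zero_or_pos c with rfl | h
    · omega
    · exact h
  refine hM ⟨fun x => min (c * x) τ', ?_, ?_⟩
  · rintro x ⟨h1, h2⟩
    have := Nat.mul_pos hc0 h1
    exact ⟨le_min this hτ', min_le_right _ _⟩
  · intro S hS
    constructor
    · intro h
      by_contra! hS'
      have h1 : (S.map fun x => min (c * x) τ').sum ≤ (S.map fun x => c * x).sum :=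
        Multiset.sum_map_le_sum_map _ _ fun x _ => min_le_left _ _
      rw [Multiset.sum_map_mul_left, Multiset.map_id'] at h1
      have h2 : c * S.sum ≤ c * (τ - 1) := Nat.mul_le_mul_left c (by omega)
      rw [mul_comm c (τ - 1)] at h2
      omega
    · intro h
      by_cases hcap : ∃ x ∈ S, τ' ≤ c * x
      · obtain ⟨x, hx, hcx⟩ := hcap
        have h1 : min (c * x) τ' ∈ S.map fun x => min (c * x) τ' :=
          Multiset.mem_map_of_mem _ hx
        have := Multiset.single_le_sum (fun _ _ => Nat.zero_le _) _ h1
        omega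
      · push Not at hcap
        rw [Multiset.map_congr rfl fun x hx => min_eq_left (hcap x hx).le,
          Multiset.sum_map_mul_left, Multiset.map_id']
        have : c * τ ≤ c * S.sum := Nat.mul_le_mul_left c h
        rw [mul_comm c τ] at this
        omega

end Boxes

/-! ### Consequences of a strong simulation -/

section Simulation

/-- All supertiles that went into a producible one are mapped below its image. -/
theorem tileSet_subset_of_merge {𝒰 𝒯 : TAS} {ρ : Supertile 𝒰.tiles → Supertile 𝒯.tiles}
    (hfol : Follows 𝒯 𝒰 ρ) {L : Multiset (Supertile 𝒰.tiles)} (hL : Within L 𝒰.init)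
    {a : Supertile 𝒰.tiles} (h : ReflTransGen (Merge 𝒰.temp) L {a}) :
    ∀ x ∈ L, (ρ x).tileSet ⊆ (ρ a).tileSet := by
  have key : ∀ M, ReflTransGen (Merge 𝒰.temp) M {a} → ReflTransGen (Merge 𝒰.temp) L M →
      ∀ x ∈ M, (ρ x).tileSet ⊆ (ρ a).tileSet := by
    intro M hM
    induction hM using ReflTransGen.head_induction_on with
    | refl =>
      intro _ x hx
      rw [Multiset.mem_singleton.1 hx]
    | head hstep _ ih =>
      intro hLM x hx
      have hLN := hLM.tail hstep
      obtain ⟨b, c, g, Q, rfl, rfl, hg, -, -⟩ := hstep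
      have hgM := ih hLN g (by simp)
      have hgp : g ∈ 𝒰.producible := producible_of_merge hL hLN (by simp)
      have hxp : x ∈ 𝒰.producible := producible_of_merge hL hLM hx
      rcases Multiset.mem_cons.1 hx with rfl | hx
      · exact (tileSet_subset_of_reachesLeOne
          (hfol _ hxp _ hgp (reachesOne_iff.2 ⟨c, hg⟩))).trans hgM
      rcases Multiset.mem_cons.1 hx with rfl | hx
      · exact (tileSet_subset_of_reachesLeOne
          (hfol _ hxp _ hgp (reachesOne_iff.2 ⟨b, combination_comm _ _ _ ▸ hg⟩))).trans hgM
      · exact ih hLN x (by simp [hx])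
  exact key L h .refl

/-- Producible supertiles whose images have no tile type in common can be produced at the same
time, because they use different initial supertiles; so whatever they combine to is producible,
even if the initial multiplicities are finite. -/
theorem producible_of_mem_combination {𝒰 : TAS} {T : Finset TileType} {τ : ℕ}
    {ρ : Supertile 𝒰.tiles → Supertile T}
    (hprod : ∀ a ∈ 𝒰.producible, ρ a ∈ (TAS.mk T (defaultState T) τ).producible)
    (hfol : Follows (TAS.mk T (defaultState T) τ) 𝒰 ρ) {α β : Assembly 𝒰.tiles}
    (hαfin : α.dom.Finite) (hβfin : β.dom.Finite) (hα : α.supertile ∈ 𝒰.producible)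
    (hβ : β.supertile ∈ 𝒰.producible)
    (hdisj : Disjoint (ρ α.supertile).tileSet (ρ β.supertile).tileSet)
    {g : Supertile 𝒰.tiles} (hg : g ∈ Combination 𝒰.temp α.supertile β.supertile) :
    g ∈ 𝒰.producible := by
  classical
  by_cases h1 : g = α.supertile
  · rwa [h1]
  by_cases h2 : g = β.supertile
  · rwa [h2]
  obtain ⟨L, hL, hr⟩ := exists_merge_of_producible hαfin hα
  obtain ⟨L', hL', hr'⟩ := exists_merge_of_producible hβfin hβ
  have hLL : Within (L + L') 𝒰.init := by
    intro w
    rw [Multiset.count_add]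
    by_cases hw : w ∈ L
    · have hw' : w ∉ L' := by
        intro hw'
        have hwp : w ∈ 𝒰.producible := producible_of_merge hL .refl hw
        obtain ⟨t, ht⟩ := tileSet_nonempty_of_producible (hprod w hwp)
        exact Set.disjoint_left.1 hdisj (tileSet_subset_of_merge hfol hL hr w hw ht)
          (tileSet_subset_of_merge hfol hL' hr' w hw' ht)
      rw [Multiset.count_eq_zero.2 hw', add_zero]
      exact hL w
    · rw [Multiset.count_eq_zero.2 hw, zero_add]
      exact hL' w
  exact producible_of_merge hLL ((reflTransGen_merge_add hr hr').tail
    ⟨_, _, g, 0, rfl, rfl, hg, h1, h2⟩) (by simp)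

variable {U : Finset TileType} {S : State U} {τ τ' m : ℕ}
  {R : Block U m → Option {t : TileType // t ∈ combTiles τ}}
  {ρ : Supertile U → Supertile (combTiles τ)} {H : ℤ}

theorem combCells_nonempty {s : Bool} {P : Set ℤ} (hH : 0 < H) : (combCells s P H).Nonempty :=
  ⟨_, mem_combCells (i := 0) le_rfl hH.le (Nat.zero_le _)⟩

theorem rep_empty_of_simulation
    (heq : EquivalentProductions ⟨U, S, τ'⟩ ⟨combTiles τ, defaultState (combTiles τ), τ⟩ R ρ) :
    R (fun _ => none) = none := by
  have h : (comb τ true ∅ 1).supertile ∈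
      (TAS.mk (combTiles τ) (defaultState (combTiles τ)) τ).producible := producible_comb one_pos
  rw [← heq.1] at h
  obtain ⟨a, ha, hρ⟩ := h
  obtain ⟨α, -, hα, hcl⟩ := heq.2.2 a ha
  rw [hρ] at hα
  obtain ⟨u, hu⟩ := Assembly.supertile_eq_iff.1 hα.symm
  refine rep_empty (α := α) ?_ hcl
  rw [← hu]
  exact Assembly.finite_dom_translate (dom_comb ▸ finite_combCells) u

/-- A comb has a stable representation, in place, that does not grow any more while it represents
the comb: take a largest one. It is stable since the comb is a product of two supertiles, and the
simulation of that attachment yields a product. -/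
theorem exists_rep_comb (hm : 1 ≤ m)
    (heq : EquivalentProductions ⟨U, S, τ'⟩ ⟨combTiles τ, defaultState (combTiles τ), τ⟩ R ρ)
    (hmod : StronglyModels ⟨U, S, τ'⟩ ⟨combTiles τ, defaultState (combTiles τ), τ⟩ ρ)
    (hH : 0 < H) (s : Bool) (P : Set ℤ) :
    ∃ α : Assembly U, α.supertile ∈ (TAS.mk U S τ').producible ∧
      ρ α.supertile = (comb τ s P H).supertile ∧ Near m 0 α (combCells s P H) ∧ α.Stable τ' ∧
      ∀ a ∈ (TAS.mk U S τ').producible, (TAS.mk U S τ').Reaches α.supertile a →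
        ρ a = (comb τ s P H).supertile → a = α.supertile := by
  have hm' : (0 : ℤ) < m := by omega
  set good : Set (Assembly U) := {α | α.supertile ∈ (TAS.mk U S τ').producible ∧
      ρ α.supertile = (comb τ s P H).supertile ∧ Near m 0 α (combCells s P H) ∧ α.Stable τ'}
    with hgood
  have hmove : ∀ α : Assembly U, α.supertile ∈ (TAS.mk U S τ').producible →
      ρ α.supertile = (comb τ s P H).supertile → α.Stable τ' → ∃ w, α.translate w ∈ good := by
    intro α hα hρ hs
    obtain ⟨w, hw⟩ := exists_near hm (rep_empty_of_simulation heq) heq.2.2 hα hρ.symm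
      (by rw [dom_comb]; exact combCells_nonempty hH)
    rw [dom_comb] at hw
    refine ⟨w, ?_, ?_, hw.translate, hs.translate w⟩ <;> rwa [Assembly.supertile_translate]
  have hne : good.Nonempty := by
    obtain ⟨c, hc, d, hd, hcd⟩ := exists_combination_comb (τ := τ) (s := s) (P := P) hH
    have hc' := hc
    have hd' := hd
    rw [← heq.1] at hc' hd'
    obtain ⟨c', hc', hρc⟩ := hc'
    obtain ⟨d', hd', hρd⟩ := hd'
    obtain ⟨c'', -, d'', -, g, hg, -, -, -, -, hρg, hgc⟩ :=
      hmod c hc d hd _ hcd c' hc' d' hd' hρc hρd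
    obtain ⟨γ, rfl⟩ := g.exists_rep
    obtain ⟨w, hw⟩ := hmove γ hg hρg (stable_of_mem_combination hgc)
    exact ⟨_, hw⟩
  set K : Set (ℤ × ℤ) := ⋃ c ∈ combCells s P H,
    Set.Icc ((m * (c.1 - 1), m * (c.2 - 1)) : ℤ × ℤ) (m * (c.1 + 2), m * (c.2 + 2)) with hK
  have hKfin : K.Finite := finite_combCells.biUnion fun c _ => Set.finite_Icc _ _
  have hsubK : ∀ α ∈ good, α.dom ⊆ K := fun α hα => hα.2.2.1.dom_subset hm'
  have hbdd : BddAbove ((fun α : Assembly U => α.supertile.size) '' good) := by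
    refine ⟨K.ncard, ?_⟩
    rintro _ ⟨α, hα, rfl⟩
    exact Set.ncard_le_ncard (hsubK α hα) hKfin
  obtain ⟨α, hα, hmax⟩ := Nat.sSup_mem (hne.image _) hbdd
  refine ⟨α, hα.1, hα.2.1, hα.2.2.1, hα.2.2.2, fun a ha hr hρa => ?_⟩
  obtain ⟨ω, rfl⟩ := a.exists_rep
  have hωfin : ω.dom.Finite := by
    obtain ⟨w, hw⟩ := exists_near hm (rep_empty_of_simulation heq) heq.2.2 ha hρa.symm
      (by rw [dom_comb]; exact combCells_nonempty hH)
    rw [dom_comb] at hw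
    have := Assembly.finite_dom_translate (hKfin.subset (hw.translate.dom_subset hm')) (-w)
    rwa [Assembly.translate_translate, add_neg_cancel, Assembly.translate_zero] at this
  obtain ⟨hωs, hω⟩ := reaches_finite (𝒯 := TAS.mk U S τ') hωfin hα.2.2.2 hr
  rcases hω with h | h
  · exact h.symm
  · exfalso
    obtain ⟨w, hw⟩ := hmove ω ha hρa hωs
    have h1 := le_csSup hbdd ⟨_, hw, rfl⟩
    rw [← hmax] at h1
    simp only [Assembly.supertile_translate] at h1
    exact absurd h1 (not_le.2 h)

theorem disjoint_tileSet_comb (P Q : Set ℤ) :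
    Disjoint (comb τ true P H).supertile.tileSet (comb τ false Q H).supertile.tileSet := by
  rw [Set.disjoint_left]
  rintro t ⟨p, hp⟩ ⟨q, hq⟩
  have h1 : p ∈ combCells true P H := by rw [← dom_comb]; exact Assembly.mem_dom_of_eq hp
  have h2 : q ∈ combCells false Q H := by rw [← dom_comb]; exact Assembly.mem_dom_of_eq hq
  rw [comb_of_mem h1, Option.some_inj] at hp
  rw [comb_of_mem h2, Option.some_inj] at hq
  have := side_eq_of_rowTile_eq (hp.trans hq.symm)
  simp at this

/-- Representations of two combs that bind do so in nearly the right relative position. -/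
theorem abs_le_of_near_union (hm : 1 ≤ m) {P Q : Set ℤ} (hP : Sparse P H) (hQ : Sparse Q H)
    (hPne : P.Nonempty) (hQne : Q.Nonempty) {α β : Assembly U} {δ w : ℤ × ℤ}
    (hα : Near m 0 α (combCells true P H)) (hβ : Near m 0 β (combCells false Q H))
    (hw : Near m w (α.union (β.translate δ)) (combCells true P H ∪ combCells false Q H)) :
    |δ.1| ≤ 5 * m ∧ |δ.2| ≤ 5 * m := by
  have hm' : (0 : ℤ) < m := by omega
  have h1 := hα.embed hm' (δ := 0) hw fun p hp => by
    rw [add_zero, Assembly.dom_union]; exact Or.inl hp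
  have h2 := hβ.embed hm' (δ := δ) hw fun p hp => by
    rw [Assembly.dom_union]
    refine Or.inr ?_
    rw [Assembly.mem_dom_translate]
    simpa using hp
  have h3 := abs_le_of_comb_near (s := true) hP hQ hPne le_rfl (by norm_num) (t := 0)
    (u := ((0 + w.1) / m, (0 + w.2) / m)) (by simp) (by simp) fun c hc => by
      obtain ⟨g, hg, h⟩ := h1 c hc
      exact ⟨g, by simpa using hg, h⟩
  have h4 := abs_le_of_comb_near (s := false) hQ hP hQne le_rfl (by norm_num) (t := 0)
    (u := ((δ.1 + w.1) / m, (δ.2 + w.2) / m)) (by simp) (by simp) fun c hc => by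
      obtain ⟨g, hg, h⟩ := h2 c hc
      exact ⟨g, by simpa using hg.symm, h⟩
  simp only [zero_add, abs_le] at h3 h4 ⊢
  have h5 := ediv_add_ediv_bounds hm' δ.1 w.1
  have h6 := ediv_add_ediv_bounds hm' δ.2 w.2
  have key : ∀ x : ℤ, -5 ≤ x / m → x / m ≤ 4 → -(5 * m) ≤ x ∧ x ≤ 5 * m := by
    intro x h1 h2
    have a1 := Int.mul_ediv_add_emod x m
    have a3 := Int.emod_nonneg x hm'.ne'
    have a5 := Int.emod_lt_of_pos x hm'
    constructor <;> nlinarith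
  exact ⟨key _ (by omega) (by omega), key _ (by omega) (by omega)⟩

/-- Two representations of combs with fewer than `τ` common teeth do not combine, in nearly the
right relative position, to a producible supertile. -/
theorem not_producible_union (hτ : 1 < τ) (hm : 1 ≤ m)
    (heq : EquivalentProductions ⟨U, S, τ'⟩ ⟨combTiles τ, defaultState (combTiles τ), τ⟩ R ρ)
    (hfol : Follows ⟨combTiles τ, defaultState (combTiles τ), τ⟩ ⟨U, S, τ'⟩ ρ)
    {P Q : Set ℤ} (hP : Sparse P H) (hQ : Sparse Q H)
    (hPne : P.Nonempty) (hQne : Q.Nonempty) {α β : Assembly U} {δ : ℤ × ℤ}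
    (hαp : α.supertile ∈ (TAS.mk U S τ').producible)
    (hβp : β.supertile ∈ (TAS.mk U S τ').producible)
    (hαρ : ρ α.supertile = (comb τ true P H).supertile)
    (hβρ : ρ β.supertile = (comb τ false Q H).supertile)
    (hα : Near m 0 α (combCells true P H)) (hβ : Near m 0 β (combCells false Q H))
    (hδ₁ : |δ.1| ≤ 5 * m) (hδ₂ : |δ.2| ≤ 5 * m)
    (hd : α.IsDisjoint (β.translate δ)) (hs : (α.union (β.translate δ)).Stable τ')
    {A : Finset ℤ} (hA : ∀ y, y ∈ P → y ∈ Q → y ∈ A) (hcard : A.card < τ) :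
    (α.union (β.translate δ)).supertile ∉ (TAS.mk U S τ').producible := by
  intro hγ
  have hm' : (0 : ℤ) < m := by omega
  have hH : 0 < H := by
    obtain ⟨j, hj⟩ := hPne
    have := hP j hj
    omega
  set γ := α.union (β.translate δ) with hγdef
  have hcomb : γ.supertile ∈ Combination τ' α.supertile β.supertile :=
    mem_combination_iff.2 ⟨δ, hd, hs, rfl⟩
  have hl := hfol _ hαp _ hγ (reachesOne_iff.2 ⟨_, hcomb⟩)
  have hr := hfol _ hβp _ hγ (reachesOne_iff.2 ⟨_, combination_comm _ _ _ ▸ hcomb⟩)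
  rw [hαρ] at hl
  rw [hβρ] at hr
  have hdisj := disjoint_tileSet_comb (τ := τ) (H := H) P Q
  have hnel : (comb τ true P H).supertile.tileSet.Nonempty :=
    tileSet_nonempty_of_producible (producible_comb hH)
  have hner : (comb τ false Q H).supertile.tileSet.Nonempty :=
    tileSet_nonempty_of_producible (producible_comb hH)
  rcases hl with hl | hl
  · have := tileSet_subset_of_reachesLeOne hr
    rw [← hl] at this
    obtain ⟨t, ht⟩ := hner
    exact Set.disjoint_left.1 hdisj (this ht) ht
  rcases hr with hr | hr
  · have := tileSet_subset_of_reachesLeOne (Or.inr hl)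
    rw [← hr] at this
    obtain ⟨t, ht⟩ := hnel
    exact Set.disjoint_left.1 hdisj ht (this ht)
  obtain ⟨x, hx⟩ := reachesOne_iff.1 hl
  obtain ⟨y, hy⟩ := reachesOne_iff.1 hr
  obtain ⟨x, rfl⟩ := x.exists_rep
  obtain ⟨y, rfl⟩ := y.exists_rep
  obtain ⟨e, hxd, hxs, hxg⟩ := mem_combination_iff.1 hx
  obtain ⟨e', hyd, hys, hyg⟩ := mem_combination_iff.1 hy
  -- `G` represents `γ`; it contains the left comb in place and the right comb shifted by `v`.
  set G := (comb τ true P H).union (x.translate e)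
  obtain ⟨v, hv⟩ := Assembly.supertile_eq_iff.1 (hyg.trans hxg.symm)
  have hGP : ∀ p ∈ combCells true P H, G p = comb τ true P H p := fun p hp =>
    Assembly.union_of_mem (by rwa [dom_comb])
  have hGQ : ∀ p ∈ combCells false Q H, G (p + v) = comb τ false Q H p := fun p hp => by
    rw [← hv, Assembly.translate_apply, add_sub_cancel_right,
      Assembly.union_of_mem (by rwa [dom_comb])]
  have hdomP : ∀ p ∈ combCells true P H, p ∈ G.dom := fun p hp => by
    rw [Assembly.mem_dom, hGP p hp]
    rwa [← dom_comb (τ := τ)] at hp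
  have hdomQ : ∀ p ∈ combCells false Q H, p + v ∈ G.dom := fun p hp => by
    rw [Assembly.mem_dom, hGQ p hp]
    rwa [← dom_comb (τ := τ)] at hp
  obtain ⟨w, hw⟩ := exists_near hm (rep_empty_of_simulation heq) heq.2.2 hγ hxg
    ⟨_, hdomP _ (combCells_nonempty hH).some_mem⟩
  -- `u` is where the grid of `γ` places the left comb, and `t` is where it places the right one,
  -- relative to the left one.
  set u : ℤ × ℤ := ((0 + w.1) / m, (0 + w.2) / m) with hu
  set t : ℤ × ℤ := ((δ.1 + w.1) / m - u.1, (δ.2 + w.2) / m - u.2) with ht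
  have ht' : |t.1| ≤ 6 ∧ |t.2| ≤ 6 := by
    rw [abs_le] at hδ₁ hδ₂
    have key : ∀ x : ℤ, -(5 * m) ≤ x → x ≤ 5 * m → -5 ≤ x / m ∧ x / m ≤ 5 := by
      intro x h1 h2
      constructor
      · rw [Int.le_ediv_iff_mul_le hm']; linarith
      · exact Int.ediv_le_of_le_mul hm' h2
    have h1 := key _ hδ₁.1 hδ₁.2
    have h2 := key _ hδ₂.1 hδ₂.2
    have h5 := ediv_add_ediv_bounds hm' δ.1 w.1
    have h6 := ediv_add_ediv_bounds hm' δ.2 w.2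
    simp only [ht, hu, zero_add, abs_le]
    omega
  have hnear : ∀ g ∈ G.dom, ∃ c, (c ∈ combCells true P H ∨ c - t ∈ combCells false Q H) ∧
      |c.1 + u.1 - g.1| ≤ 2 ∧ |c.2 + u.2 - g.2| ≤ 2 := by
    intro g hg
    obtain ⟨p, hp, h1, h2⟩ := hw.2 g hg
    rw [hγdef, Assembly.dom_union] at hp
    rcases hp with hp | hp
    · obtain ⟨c, hc, h3, h4⟩ := hα.cover hm' (w := w) (δ := 0) (p := p) (by simpa using hp)
      exact ⟨c, Or.inl hc, h1 ▸ h3, h2 ▸ h4⟩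
    · obtain ⟨c, hc, h3, h4⟩ := hβ.cover hm' (w := w) (δ := δ) (p := p) hp
      refine ⟨c + t, Or.inr (by simpa using hc), ?_, ?_⟩
      · simp only [ht, Prod.fst_add]
        rw [show c.1 + ((δ.1 + w.1) / m - u.1) + u.1 = c.1 + (δ.1 + w.1) / m by ring, ← h1]
        exact h3
      · simp only [ht, Prod.snd_add]
        rw [show c.2 + ((δ.2 + w.2) / m - u.2) + u.2 = c.2 + (δ.2 + w.2) / m by ring, ← h2]
        exact h4
  have hleft := abs_le_of_comb_near (s := true) hP hQ hPne (by norm_num)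
    (by norm_num : (6 : ℤ) ≤ 40) (t := t) (u := -u) ht'.1 ht'.2 fun c hc => by
      obtain ⟨g, hg, h1, h2⟩ := hnear c (hdomP c hc)
      refine ⟨g, hg, ?_, ?_⟩
      · rw [abs_sub_comm] at h1
        simpa only [Prod.fst_neg, ← sub_eq_add_neg, sub_sub, add_comm u.1] using h1
      · rw [abs_sub_comm] at h2
        simpa only [Prod.snd_neg, ← sub_eq_add_neg, sub_sub, add_comm u.2] using h2
  have hright := abs_le_of_comb_near (s := false) hQ hP hQne (by norm_num)
    (by norm_num : (6 : ℤ) ≤ 40) (t := -t) (u := v - u - t) (by simpa using ht'.1)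
    (by simpa using ht'.2) fun c hc => by
      obtain ⟨g, hg, h1, h2⟩ := hnear _ (hdomQ c hc)
      refine ⟨g - t, hg.symm.imp id fun h => by simpa using h, ?_, ?_⟩
      · rw [abs_sub_comm] at h1
        simp only [Prod.fst_sub, Prod.fst_add] at h1 ⊢
        rw [show c.1 + (v.1 - u.1 - t.1) - (g.1 - t.1) = c.1 + v.1 - (g.1 + u.1) by ring]
        exact h1
      · rw [abs_sub_comm] at h2
        simp only [Prod.snd_sub, Prod.snd_add] at h2 ⊢
        rw [show c.2 + (v.2 - u.2 - t.2) - (g.2 - t.2) = c.2 + v.2 - (g.2 + u.2) by ring]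
        exact h2
  have hvbound : |v.1| ≤ 50 ∧ |v.2| ≤ 50 := by
    simp only [abs_le, Prod.fst_neg, Prod.snd_neg, Prod.fst_sub, Prod.snd_sub]
      at hleft hright ht' ⊢
    omega
  exact not_stable_of_comb_subset hτ hxs hH hP hQ hGP hvbound.1 hvbound.2 hGQ hA hcard

end Simulation

/-! ### Absence of a strong simulation -/

section Final

/-- The row of the tooth of slot `k` for the choice `w`; slot `k` offers `q` rows. -/
def toothRow (q : ℕ) {K : ℕ} (w : Fin K → ℕ) (k : Fin K) : ℤ := 1000 * ((k * q + w k + 1 : ℕ) : ℤ)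

theorem toothRow_inj {q K : ℕ} {w w' : Fin K → ℕ} {k k' : Fin K} (hw : w k < q)
    (hw' : w' k' < q) (h : toothRow q w k = toothRow q w' k') : k = k' ∧ w k = w' k' := by
  have h1 : (k : ℕ) * q + w k = k' * q + w' k' := by
    simp only [toothRow] at h
    omega
  have h2 : (k : ℕ) = k' := by
    rcases lt_trichotomy (k : ℕ) k' with hlt | heq | hlt
    · have := Nat.mul_le_mul_right q (Nat.succ_le_of_lt hlt)
      rw [Nat.succ_mul] at this
      omega
    · exact heq
    · have := Nat.mul_le_mul_right q (Nat.succ_le_of_lt hlt)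
      rw [Nat.succ_mul] at this
      omega
  refine ⟨Fin.ext h2, ?_⟩
  rw [h2] at h1
  omega

theorem sparse_range_toothRow {q K : ℕ} {w : Fin K → ℕ} (hw : ∀ k, w k < q) :
    Sparse (Set.range (toothRow q w)) (1000 * ((K * q + 1 : ℕ) : ℤ)) := by
  rintro _ ⟨k, rfl⟩
  refine ⟨⟨_, rfl⟩, by simp only [toothRow]; omega, ?_⟩
  have h1 := Nat.mul_le_mul_right q (Nat.succ_le_of_lt k.2)
  have h2 := hw k
  rw [Nat.succ_mul] at h1
  simp only [toothRow]
  omega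

theorem mem_image_toothRow_iff {q K : ℕ} {y z : Fin K → ℕ}
    (hyz : ∀ k, y k < q ∧ z k < q ∧ y k ≠ z k) (B : Finset (Fin K)) (j : ℤ) :
    j ∈ B.image (toothRow q y) ↔ j ∈ Set.range (toothRow q y) ∧
      j ∈ Set.range (toothRow q fun k => if k ∈ B then y k else z k) := by
  rw [Finset.mem_image]
  constructor
  · rintro ⟨k, hk, rfl⟩
    exact ⟨⟨k, rfl⟩, ⟨k, by simp [toothRow, hk]⟩⟩
  · rintro ⟨⟨k, rfl⟩, ⟨k', hk'⟩⟩
    obtain ⟨rfl, h2⟩ := toothRow_inj (by split_ifs <;> [exact (hyz k').1; exact (hyz k').2.1])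
      (hyz k).1 hk'
    refine ⟨k', ?_, rfl⟩
    by_contra hk
    rw [if_neg hk] at h2
    exact (hyz k').2.2 h2.symm

/-- The tile set of the combs is not strongly simulated at temperature `τ'`. -/
theorem not_stronglySimulates_combTiles {τ τ' : ℕ} (hτ : 1 < τ) (hτ' : 0 < τ')
    (hM : ¬ HasUniformMapping τ τ') (U : Finset TileType) (S : State U) :
    ¬ StronglySimulates ⟨U, S, τ'⟩ ⟨combTiles τ, defaultState (combTiles τ), τ⟩ := by
  classical
  rintro ⟨m, R, ρ, hm, heq, hfol, hmod⟩
  simp only at R ρ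
  let W : Type := {o : ℤ × ℤ // o ∈ windowBox m} → Option {t : TileType // t ∈ U}
  let K : ℕ := Nat.card (W × W) * (τ - 1) + 1
  obtain ⟨q, hq⟩ := exists_monochromatic_box K (Fin K → W × W)
  set H : ℤ := 1000 * ((K * q + 1 : ℕ) : ℤ) with hHdef
  have hH : 0 < H := by omega
  choose α hαp hαρ hα hαs hαmax using fun w : Fin K → ℕ =>
    exists_rep_comb hm heq hmod hH true (Set.range (toothRow q w))
  choose β hβp hβρ hβ hβs hβmax using fun w : Fin K → ℕ =>
    exists_rep_comb hm heq hmod hH false (Set.range (toothRow q w))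
  obtain ⟨y, z, hyz, hmono⟩ := hq fun w k =>
    (window m (α w) (toothRow q w k), window m (β w) (toothRow q w k))
  -- Many slots look alike.
  obtain ⟨A₁, hA₁, hwin⟩ : ∃ A₁ : Finset (Fin K), A₁.card = τ ∧ ∃ c : W × W, ∀ k ∈ A₁,
      (window m (α y) (toothRow q y k), window m (β y) (toothRow q y k)) = c := by
    have : Fintype (W × W) := Fintype.ofFinite _
    obtain ⟨c, hc⟩ := Fintype.exists_lt_card_fiber_of_mul_lt_card
      (f := fun k : Fin K => ((window m (α y) (toothRow q y k),
        window m (β y) (toothRow q y k)) : W × W)) (n := τ - 1) (by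
          rw [Fintype.card_fin, ← Nat.card_eq_fintype_card]
          exact Nat.lt_succ_self _)
    obtain ⟨A₁, hsub, hcard⟩ := Finset.exists_subset_card_eq (Nat.le_of_pred_lt hc)
    exact ⟨A₁, hcard, c, fun k hk => (Finset.mem_filter.1 (hsub hk)).2⟩
  obtain ⟨k₀, hk₀⟩ : A₁.Nonempty := Finset.card_pos.1 (by omega)
  obtain ⟨c, hc⟩ := hwin
  set A₂ := A₁.erase k₀ with hA₂
  -- The right combs that agree with the left one in the slots of `A₁` and of `A₂`.
  let zz : Finset (Fin K) → Fin K → ℕ := fun B k => if k ∈ B then y k else z k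
  have hzlt : ∀ B k, zz B k < q := fun B k => by
    simp only [zz]
    split_ifs
    exacts [(hyz k).1, (hyz k).2.1]
  have hwz : ∀ B : Finset (Fin K), ∀ k ∈ B,
      window m (β (zz B)) (toothRow q y k) = window m (β y) (toothRow q y k) := by
    intro B k hk
    have h1 := hmono (zz B) fun k => by
      simp only [zz]
      split_ifs <;> simp
    have h2 := (Prod.ext_iff.1 (congrFun h1 k)).2
    have h3 : toothRow q (zz B) k = toothRow q y k := by simp [toothRow, zz, hk]
    simpa only [h3] using h2
  have hsy := sparse_range_toothRow fun k => (hyz k).1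
  have hsz := fun B => sparse_range_toothRow (hzlt B)
  have hney : (Set.range (toothRow q y)).Nonempty := ⟨_, k₀, rfl⟩
  have hnez : ∀ B, (Set.range (toothRow q (zz B))).Nonempty := fun B => ⟨_, k₀, rfl⟩
  have hinj : Function.Injective (toothRow q y) := fun k k' h =>
    (toothRow_inj (hyz k).1 (hyz k').1 h).1
  have hcard : ∀ B : Finset (Fin K), (B.image (toothRow q y)).card = B.card := fun B =>
    Finset.card_image_of_injective B hinj
  -- The simulation makes the pair with `τ` common teeth bind.
  set g := (comb τ true (Set.range (toothRow q y)) H).union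
    (comb τ false (Set.range (toothRow q (zz A₁))) H) with hg
  have hgs : g.Stable τ := stable_union_comb hH hsy (hsz A₁)
    (fun j hj => (mem_image_toothRow_iff hyz A₁ j).1 hj) (by rw [hcard, hA₁])
  obtain ⟨a, ha, b, hb, g', hg', hra, hrb, hρa, hρb, hρg, hcomb⟩ :=
    hmod _ (producible_comb hH) _ (producible_comb hH) g.supertile
      ⟨_, _, rfl, rfl, isDisjoint_comb, hgs, rfl⟩ _ (hαp y) _ (hβp (zz A₁)) (hαρ y)
      (hβρ (zz A₁))
  rw [hαmax y a ha hra hρa, hβmax (zz A₁) b hb hrb hρb] at hcomb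
  obtain ⟨δ, hd, hs, rfl⟩ := mem_combination_iff.1 hcomb
  have hgdom : g.dom = combCells true (Set.range (toothRow q y)) H ∪
      combCells false (Set.range (toothRow q (zz A₁))) H := by
    rw [hg, Assembly.dom_union, dom_comb, dom_comb]
  obtain ⟨w, hw⟩ := exists_near hm (rep_empty_of_simulation heq) heq.2.2 hg' hρg.symm
    (by rw [hgdom]; exact (combCells_nonempty hH).inl)
  rw [hgdom] at hw
  obtain ⟨hδ₁, hδ₂⟩ := abs_le_of_near_union hm hsy (hsz A₁) hney (hnez A₁) (hα y) (hβ _) hw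
  have hdomne : ∀ {γ : Assembly U} {s P}, Near m 0 γ (combCells s P H) → γ.dom.Nonempty := by
    intro γ s P h
    obtain ⟨p, hp, -⟩ := h.2 _ (combCells_nonempty hH).some_mem
    exact ⟨p, hp⟩
  -- Hence the pair with one common tooth less binds as well.
  obtain ⟨hd', hs'⟩ := stable_of_fewer_teeth hm
    (le_mul_of_not_hasUniformMapping (by omega) hτ' hM) hsy (hsz A₁) (hsz A₂) (hα y) (hβ (zz A₁))
    (hβ (zz A₂)) (hαs y) (hβs (zz A₂)) hδ₁ hδ₂ (mem_image_toothRow_iff hyz A₁)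
    (mem_image_toothRow_iff hyz A₂) (Finset.image_subset_image (Finset.erase_subset _ _))
    (by rw [hcard, hA₁]) (by rw [hcard, hA₂, Finset.card_erase_of_mem hk₀, hA₁])
    (j₀ := toothRow q y k₀)
    (by
      intro j hj
      obtain ⟨k, hk, rfl⟩ := Finset.mem_image.1 hj
      exact (Prod.ext_iff.1 ((hc k hk).trans (hc k₀ hk₀).symm)).1)
    (by
      intro j hj
      obtain ⟨k, hk, rfl⟩ := Finset.mem_image.1 hj
      rw [hwz A₁ k hk, hwz A₁ k₀ hk₀]
      exact (Prod.ext_iff.1 ((hc k hk).trans (hc k₀ hk₀).symm)).2)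
    (by
      intro j hj
      obtain ⟨k, hk, rfl⟩ := Finset.mem_image.1 hj
      rw [hwz A₂ k hk, hwz A₁ k (Finset.mem_of_mem_erase hk)])
    hd hs (hdomne (hα y)) (hdomne (hβ _))
  have hfin : ∀ {γ : Assembly U} {s P}, Near m 0 γ (combCells s P H) → γ.dom.Finite :=
    fun h => (finite_combCells.biUnion fun c _ => Set.finite_Icc _ _).subset
      (h.dom_subset (by omega))
  refine not_producible_union hτ hm heq hfol hsy (hsz A₂) hney (hnez A₂) (hαp y) (hβp (zz A₂))
    (hαρ y) (hβρ (zz A₂)) (hα y) (hβ (zz A₂)) hδ₁ hδ₂ hd' hs'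
    (fun j h h' => (mem_image_toothRow_iff hyz A₂ j).2 ⟨h, h'⟩)
    (by rw [hcard, hA₂, Finset.card_erase_of_mem hk₀, hA₁]; omega) ?_
  refine producible_of_mem_combination (𝒰 := ⟨U, S, τ'⟩) (fun a ha => ?_) hfol (hfin (hα y))
    (hfin (hβ (zz A₂))) (hαp y) (hβp (zz A₂)) ?_ (mem_combination_iff.2 ⟨δ, hd', hs', rfl⟩)
  · rw [← heq.1]
    exact ⟨a, ha, rfl⟩
  · rw [hαρ, hβρ]
    exact disjoint_tileSet_comb _ _

end Final

end TwoHAM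

theorem mainTheorem1 (τ τ' : ℕ) (hτ : 2 < τ) (hττ' : τ < τ')
    (hM : ¬ TwoHAM.HasUniformMapping τ τ') (U : Finset TwoHAM.TileType) :
    ∃ T : Finset TwoHAM.TileType, ∀ S : TwoHAM.State U,
      ¬ TwoHAM.StronglySimulates ⟨U, S, τ'⟩ ⟨T, TwoHAM.defaultState T, τ⟩ :=
  ⟨TwoHAM.combTiles τ, TwoHAM.not_stronglySimulates_combTiles (by omega) (by omega) hM U⟩
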